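/- Let $M$ be a von Neumann algebra with a faithful normal tracial state $\tau$, and let $L^p(M)=L^p(M,\tau)$ $(p=1,2)$ be the completion of $M$ in the norm $\tau(|x|^p)^{1/p}$. Products $x^*y\in L^1(M)$ of $x,y\in L^2(M)$ and $xa\in L^2(M)$ of $x\in L^2(M)$, $a\in M$ are the usual ones. Let $A$ be a tracial subalgebra of $M$: a weak* closed unital subalgebra such that the faithful normal conditional expectation $\Phi$ of $M$ onto $\mathcal D:=A\cap A^*$ with $\tau\circ\Phi=\tau$ is multiplicative on $A$. Put $A_0=A\cap\operatorname{Ker}\Phi$, and let $L^1(\mathcal D)$ be the closure of $\mathcal D$ in $L^1(M)$. For a subspace $X\subset L^2(M)$ and $S\subset M$, let $[XS]_2$ be the closed linear span in $L^2(M)$ of $\{xa: x\in X,\ a\in S\}$. A (right $A$-)invariant subspace is a closed subspace $K$ of $L^2(M)$ with $KA\subset K$; it is simply invariant if $[KA_0]_2\subsetneq K$; its right wandering subspace is $K\ominus[KA_0]_2$; it is of type 2 if its right wandering subspace is $(0)$. A subspace $X$ of $L^2(M)$ is the column sum $X_1\oplus^{col}X_2$ of subspaces $X_1,X_2$ of $X$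 if $X_1+X_2$ is dense in $X$ and $X_1^*X_2=X_2^*X_1=\{0\}$. Say that $(Z,Y)$ is a decomposition of a subspace $X$ of $L^2(M)$ if $Z,Y$ are closed subspaces of $X$, $Z$ is a type 2 invariant subspace, $y^*x\in L^1(\mathcal D)$ for all $x,y\in Y$, and $X=Z\oplus^{col}[YA]_2$. Then: 1. If $(Z,Y)$ is a decomposition of $X$, then $X$ is simply invariant if and only if $Y\neq\{0\}$. 2. If $(Z,Y)$ is a decomposition of $X$, then $[Y\mathcal D]_2=X\ominus[XA_0]_2$, and $X=[XA_0]_2\oplus[Y\mathcal D]_2$ (orthogonal sum). 3. If $(Z,Y)$ is a decomposition of $X$, then so is $(Z,[Y\mathcal D]_2)$, and $[Y\mathcal D]_2$ is a right $\mathcal D$-submodule of $X$. 4. If $(Z,Y)$ and $(Z',Y')$ are decompositions of the same $X$, then $Z=Z'$ and $[Y\mathcal D]_2=[Y'\mathcal D]_2$; if moreover $Y$ and $Y'$ are right $\mathcal D$-submodules, then $Y=Y'$. 5. If $A$ is maximal subdiagonal (that is, $A+A^*$ is weak* dense in $M$), then for every right $A$-invariant subspace $X$ of $L^2(M)$ there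 is a $Z$ such that $(Z,Y)$ is a decomposition of $X$, where $Y=X\ominus[XA_0]_2$ is the right wandering subspace of $X$. -/

import Mathlib

open scoped ComplexOrder InnerProductSpace Topology

noncomputable section

/-! ### Noncommutative `L¹` and `L²` spaces of a tracial state -/

/-- A faithful tracial state on a unital C⋆-algebra. -/
structure FaithfulTracialState (M : Type*) [CStarAlgebra M] [PartialOrder M] [StarOrderedRing M]
    extends M →ₚ[ℂ] ℂ where
  map_one' : toFun 1 = 1
  map_mul_comm' : ∀ x y : M, toFun (x * y) = toFun (y * x)
  faithful' : ∀ x : M, toFun (star x * x) = 0 → x = 0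

namespace FaithfulTracialState

section

variable {M : Type*} [CStarAlgebra M] [PartialOrder M] [StarOrderedRing M]
  (τ : FaithfulTracialState M)

/-- The trace as a positive linear functional. -/
abbrev tr : M →ₚ[ℂ] ℂ := τ.toPositiveLinearMap

theorem tr_one : τ.tr 1 = 1 := τ.map_one'

theorem tr_mul_comm (x y : M) : τ.tr (x * y) = τ.tr (y * x) := τ.map_mul_comm' x y

/-- `L²(M, τ)`: the Hilbert space completion of `M` for the inner product `τ(x⋆ y)`. -/
abbrev L2 : Type _ := τ.tr.GNS

/-- The embedding of `M`, with the norm `‖x‖₂ = τ(x⋆ x)^{1/2}`, into its completion. -/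
def coeL2 : τ.tr.PreGNS →L[ℂ] τ.L2 := UniformSpace.Completion.toComplL

/-- The canonical map `M → L²(M, τ)`. -/
def toL2 : M →ₗ[ℂ] τ.L2 := τ.coeL2.toLinearMap ∘ₗ τ.tr.toPreGNS.toLinearMap

/-- `‖x‖₁ = τ(|x|)`. -/
def norm1 (x : M) : ℝ := (τ.tr (CFC.abs x)).re

theorem norm_tr_mul_le_two (x y : M) :
    ‖τ.tr (star x * y)‖ ≤ ‖τ.tr.toPreGNS x‖ * ‖τ.tr.toPreGNS y‖ := by
  have := norm_inner_le_norm (𝕜 := ℂ) (τ.tr.toPreGNS x) (τ.tr.toPreGNS y)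
  simpa [PositiveLinearMap.preGNS_inner_def] using this

theorem norm_two_mul_left_le (a x : M) :
    ‖τ.tr.toPreGNS (a * x)‖ ≤ ‖a‖ * ‖τ.tr.toPreGNS x‖ := by
  have h := (τ.tr.leftMulMapPreGNS a).le_opNorm (τ.tr.toPreGNS x)
  have h2 : ‖τ.tr.leftMulMapPreGNS a‖ ≤ ‖a‖ :=
    LinearMap.mkContinuous_norm_le _ (norm_nonneg _) _
  refine le_trans (le_of_eq ?_) (h.trans (mul_le_mul_of_nonneg_right h2 (norm_nonneg _)))
  simp

theorem norm_two_star (x : M) : ‖τ.tr.toPreGNS (star x)‖ = ‖τ.tr.toPreGNS x‖ := by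
  rw [PositiveLinearMap.preGNS_norm_def, PositiveLinearMap.preGNS_norm_def]
  simp only [PositiveLinearMap.ofPreGNS_toPreGNS, star_star]
  rw [τ.tr_mul_comm]

theorem norm_two_mul_right_le (x a : M) :
    ‖τ.tr.toPreGNS (x * a)‖ ≤ ‖a‖ * ‖τ.tr.toPreGNS x‖ := by
  rw [← τ.norm_two_star (x * a), star_mul, ← τ.norm_two_star x, ← norm_star a]
  exact τ.norm_two_mul_left_le _ _

theorem norm1_nonneg (x : M) : 0 ≤ τ.norm1 x :=
  (Complex.nonneg_iff.mp (τ.tr.map_nonneg (CFC.abs_nonneg x))).1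

theorem continuousOn_inv_add {z : M} {ε : ℝ} (hε : 0 < ε) :
    ContinuousOn (fun t : ℝ => (t + ε)⁻¹) (spectrum ℝ (CFC.abs z)) :=
  (continuous_id.add continuous_const).continuousOn.inv₀ fun _ ht =>
    (add_pos_of_nonneg_of_pos (spectrum_nonneg_of_nonneg (CFC.abs_nonneg z) ht) hε).ne'

/-- `z g(|z|)` is a contraction for `g(t) = (t + ε)⁻¹`. -/
theorem norm_mul_cfc_abs_le (z : M) {ε : ℝ} (hε : 0 < ε) :
    ‖z * cfc (fun t : ℝ => (t + ε)⁻¹) (CFC.abs z)‖ ≤ 1 := by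
  set p := CFC.abs z with hp
  have hp0 : 0 ≤ p := CFC.abs_nonneg z
  set g : ℝ → ℝ := fun t => (t + ε)⁻¹ with hg
  have hgc : ContinuousOn g (spectrum ℝ p) := continuousOn_inv_add hε
  have hsa : IsSelfAdjoint (cfc g p) := cfc_predicate g p
  have key : star (z * cfc g p) * (z * cfc g p) = cfc (fun t => g t * (t * t * g t)) p := by
    rw [cfc_mul g (fun t => t * t * g t) p hgc (by fun_prop),
      cfc_mul (fun t => t * t) g p (by fun_prop) hgc,
      cfc_mul (fun t : ℝ => t) (fun t => t) p (by fun_prop) (by fun_prop), cfc_id' ℝ p,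
      show p * p = star z * z from CFC.abs_mul_abs z, star_mul, hsa.star_eq]
    simp only [mul_assoc]
  have h1 : ‖cfc (fun t => g t * (t * t * g t)) p‖ ≤ 1 := by
    refine norm_cfc_le zero_le_one fun t ht => ?_
    have ht0 : 0 ≤ t := spectrum_nonneg_of_nonneg hp0 ht
    have hb : t * g t ≤ 1 := by
      rw [hg, ← div_eq_mul_inv]
      exact (div_le_one (by positivity)).2 (by linarith)
    have hb0 : 0 ≤ t * g t := mul_nonneg ht0 (inv_nonneg.2 (by linarith))
    rw [Real.norm_eq_abs, show g t * (t * t * g t) = (t * g t) * (t * g t) by ring,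
      abs_of_nonneg (mul_nonneg hb0 hb0)]
    nlinarith
  rw [← key, CStarRing.norm_star_mul_self] at h1
  nlinarith [norm_nonneg (z * cfc g p)]

/-- `‖z‖₁` is approximated by the values `|τ(z a)|` with `a` in the unit ball. -/
theorem exists_norm1_le (z : M) {ε : ℝ} (hε : 0 < ε) :
    ∃ a : M, ‖a‖ ≤ 1 ∧ τ.norm1 z ≤ ‖τ.tr (z * a)‖ + ε := by
  have hp0 : 0 ≤ CFC.abs z := CFC.abs_nonneg z
  have hgc : ContinuousOn (fun t : ℝ => (t + ε)⁻¹) (spectrum ℝ (CFC.abs z)) :=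
    continuousOn_inv_add hε
  have hsa : IsSelfAdjoint (cfc (fun t : ℝ => (t + ε)⁻¹) (CFC.abs z)) := cfc_predicate _ _
  refine ⟨star (z * cfc (fun t : ℝ => (t + ε)⁻¹) (CFC.abs z)), ?_, ?_⟩
  · rw [norm_star]; exact norm_mul_cfc_abs_le z hε
  have e1 : τ.tr (z * star (z * cfc (fun t : ℝ => (t + ε)⁻¹) (CFC.abs z)))
      = τ.tr (cfc (fun t : ℝ => (t + ε)⁻¹ * (t * t)) (CFC.abs z)) := by
    rw [τ.tr_mul_comm, star_mul, hsa.star_eq, mul_assoc, ← CFC.abs_mul_abs,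
      cfc_mul _ (fun t : ℝ => t * t) _ hgc (by fun_prop),
      cfc_mul (fun t : ℝ => t) (fun t => t) _ (by fun_prop) (by fun_prop), cfc_id' ℝ (CFC.abs z)]
  have e2 : CFC.abs z ≤ cfc (fun t : ℝ => (t + ε)⁻¹ * (t * t)) (CFC.abs z)
      + algebraMap ℝ M ε := by
    rw [← cfc_const ε (CFC.abs z), ← cfc_add (CFC.abs z) (hf := by fun_prop) (hg := by fun_prop)]
    conv_lhs => rw [← cfc_id' ℝ (CFC.abs z)]
    refine cfc_mono (fun t ht => ?_) (by fun_prop) (by fun_prop)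
    have ht0 : 0 ≤ t := spectrum_nonneg_of_nonneg hp0 ht
    have : 0 < t + ε := by linarith
    rw [← sub_nonneg, show (t + ε)⁻¹ * (t * t) + ε - t = ε * ε * (t + ε)⁻¹ by field_simp; ring]
    positivity
  have e3 : τ.tr (CFC.abs z) ≤ τ.tr (cfc (fun t : ℝ => (t + ε)⁻¹ * (t * t)) (CFC.abs z)) + ε := by
    have := OrderHomClass.mono τ.tr e2
    rwa [map_add, Algebra.algebraMap_eq_smul_one, ← Complex.coe_smul, map_smul, τ.tr_one,
      smul_eq_mul, mul_one] at this
  rw [e1, norm1]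
  have e4 := (Complex.le_def.1 e3).1
  rw [Complex.add_re, Complex.ofReal_re] at e4
  exact e4.trans (by gcongr; exact Complex.re_le_norm _)

/-- `|τ(z a)| ≤ ‖a‖ ‖z‖₁`. -/
theorem norm_tr_mul_le_norm1 (z a : M) : ‖τ.tr (z * a)‖ ≤ ‖a‖ * τ.norm1 z := by
  have main : ∀ ε : ℝ, 0 < ε → ‖τ.tr (z * a)‖ ≤ ‖a‖ * (τ.norm1 z + ε) := by
    intro ε hε
    have hp0 : 0 ≤ CFC.abs z := CFC.abs_nonneg z
    have hgc : ContinuousOn (fun t : ℝ => (t + ε)⁻¹) (spectrum ℝ (CFC.abs z)) :=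
      continuousOn_inv_add hε
    have hb := norm_mul_cfc_abs_le z hε
    set b := z * cfc (fun t : ℝ => (t + ε)⁻¹) (CFC.abs z) with hbdef
    set s := cfc (fun t : ℝ => √(t + ε)) (CFC.abs z) with hsdef
    have hsa : star s = s := (cfc_predicate _ _ : IsSelfAdjoint s).star_eq
    have hss : s * s = CFC.abs z + algebraMap ℝ M ε := by
      calc s * s = cfc (fun t : ℝ => √(t + ε) * √(t + ε)) (CFC.abs z) :=
            (cfc_mul _ _ _ (by fun_prop) (by fun_prop)).symm
        _ = cfc (fun t : ℝ => t + ε) (CFC.abs z) := by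
            refine cfc_congr fun t ht => ?_
            have ht0 : 0 ≤ t := spectrum_nonneg_of_nonneg hp0 ht
            exact Real.mul_self_sqrt (by linarith)
        _ = CFC.abs z + algebraMap ℝ M ε := by
            rw [cfc_add (CFC.abs z) (fun t : ℝ => t) (fun _ => ε), cfc_id' ℝ (CFC.abs z),
              cfc_const ε (CFC.abs z)]
    have hinv : cfc (fun t : ℝ => (t + ε)⁻¹) (CFC.abs z) * (s * s) = 1 := by
      rw [hss, ← cfc_const ε (CFC.abs z)]
      nth_rewrite 2 [← cfc_id' ℝ (CFC.abs z)]
      rw [← cfc_add (CFC.abs z) (fun t : ℝ => t) (fun _ => ε),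
        ← cfc_mul _ _ _ hgc (by fun_prop), ← cfc_const_one ℝ (CFC.abs z)]
      refine cfc_congr fun t ht => ?_
      have ht0 : 0 ≤ t := spectrum_nonneg_of_nonneg hp0 ht
      exact inv_mul_cancel₀ (by linarith)
    have hz : z = b * (s * s) := by
      rw [hbdef, mul_assoc, hinv, mul_one]
    have e1 : τ.tr (z * a) = τ.tr (star s * (a * b * s)) := by
      rw [hz, hsa, τ.tr_mul_comm s, τ.tr_mul_comm]
      simp only [mul_assoc]
    have e2 : ‖τ.tr.toPreGNS s‖ * ‖τ.tr.toPreGNS s‖ = τ.norm1 z + ε := by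
      have h := τ.tr.preGNS_norm_sq (τ.tr.toPreGNS s)
      rw [PositiveLinearMap.ofPreGNS_toPreGNS, hsa, hss, map_add,
        Algebra.algebraMap_eq_smul_one, ← Complex.coe_smul, map_smul, τ.tr_one,
        smul_eq_mul, mul_one] at h
      have h' := congrArg Complex.re h
      rw [← Complex.ofReal_pow, Complex.ofReal_re, Complex.add_re, Complex.ofReal_re] at h'
      rw [← sq, h', norm1]
    rw [e1]
    calc _ ≤ ‖τ.tr.toPreGNS s‖ * ‖τ.tr.toPreGNS (a * b * s)‖ := τ.norm_tr_mul_le_two _ _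
      _ ≤ ‖τ.tr.toPreGNS s‖ * (‖a * b‖ * ‖τ.tr.toPreGNS s‖) := by
        gcongr; exact τ.norm_two_mul_left_le _ _
      _ = ‖a * b‖ * (τ.norm1 z + ε) := by rw [← e2]; ring
      _ ≤ ‖a‖ * (τ.norm1 z + ε) := by
        have : 0 ≤ τ.norm1 z + ε := by linarith [τ.norm1_nonneg z]
        gcongr
        exact (norm_mul_le _ _).trans (mul_le_of_le_one_right (norm_nonneg _) hb)
  refine le_of_forall_pos_le_add fun δ hδ => ?_
  have hpos : 0 < ‖a‖ + 1 := by positivity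
  refine (main (δ / (‖a‖ + 1)) (by positivity)).trans ?_
  rw [mul_add]
  gcongr
  rw [mul_div_assoc', div_le_iff₀ hpos]
  nlinarith

theorem norm1_add_le (x y : M) : τ.norm1 (x + y) ≤ τ.norm1 x + τ.norm1 y := by
  refine le_of_forall_pos_le_add fun ε hε => ?_
  obtain ⟨a, ha, h⟩ := τ.exists_norm1_le (x + y) hε
  refine h.trans (add_le_add_left ?_ ε)
  rw [add_mul, map_add]
  refine (norm_add_le _ _).trans (add_le_add ?_ ?_)
  · exact (τ.norm_tr_mul_le_norm1 x a).trans (mul_le_of_le_one_left (τ.norm1_nonneg x) ha)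
  · exact (τ.norm_tr_mul_le_norm1 y a).trans (mul_le_of_le_one_left (τ.norm1_nonneg y) ha)

theorem norm1_smul (c : ℂ) (x : M) : τ.norm1 (c • x) = ‖c‖ * τ.norm1 x := by
  rw [norm1, CFC.abs_smul, ← Complex.coe_smul, map_smul, smul_eq_mul, Complex.re_ofReal_mul, norm1]

/-- `‖x⋆ y‖₁ ≤ ‖x‖₂ ‖y‖₂`. -/
theorem norm1_star_mul_le (x y : M) :
    τ.norm1 (star x * y) ≤ ‖τ.tr.toPreGNS x‖ * ‖τ.tr.toPreGNS y‖ := by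
  refine le_of_forall_pos_le_add fun ε hε => ?_
  obtain ⟨a, ha, h⟩ := τ.exists_norm1_le (star x * y) hε
  refine h.trans (add_le_add_left ?_ ε)
  rw [mul_assoc]
  refine (τ.norm_tr_mul_le_two _ _).trans ?_
  gcongr
  exact (τ.norm_two_mul_right_le y a).trans (mul_le_of_le_one_left (norm_nonneg _) ha)

/-- The algebra `M` with the norm `‖x‖₁ = τ(|x|)`. -/
def PreL1 (_τ : FaithfulTracialState M) : Type _ := M

instance : AddCommGroup τ.PreL1 := inferInstanceAs (AddCommGroup M)
instance : Module ℂ τ.PreL1 := inferInstanceAs (Module ℂ M)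

/-- The identity map from `M` to `M` with the norm `‖x‖₁`. -/
def toPreL1 : M ≃ₗ[ℂ] τ.PreL1 := LinearEquiv.refl ℂ _

/-- `‖x‖₁` as a seminorm. -/
def seminorm1 : Seminorm ℂ τ.PreL1 :=
  Seminorm.of (fun x => τ.norm1 (τ.toPreL1.symm x))
    (fun x y => by simpa using τ.norm1_add_le (τ.toPreL1.symm x) (τ.toPreL1.symm y))
    (fun c x => by simpa using τ.norm1_smul c (τ.toPreL1.symm x))

instance : SeminormedAddCommGroup τ.PreL1 := τ.seminorm1.toSeminormedAddCommGroup

instance : NormedSpace ℂ τ.PreL1 where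
  norm_smul_le c x := (map_smul_eq_mul τ.seminorm1 c x).le

theorem norm_toPreL1 (x : M) : ‖τ.toPreL1 x‖ = (τ.tr (CFC.abs x)).re := rfl

/-- `L¹(M, τ)`: the completion of `M` for the norm `τ(|x|)`. -/
abbrev L1 : Type _ := UniformSpace.Completion τ.PreL1

/-- The canonical map `M → L¹(M, τ)`. -/
def toL1 : M →ₗ[ℂ] τ.L1 :=
  (UniformSpace.Completion.toComplL (𝕜 := ℂ) (E := τ.PreL1)).toLinearMap ∘ₗ
    τ.toPreL1.toLinearMap

theorem norm_toL1 (x : M) : ‖τ.toL1 x‖ = τ.norm1 x :=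
  UniformSpace.Completion.norm_coe (τ.toPreL1 x)

/-- Right multiplication `x ↦ x a` on `M` with the norm `‖x‖₂`. -/
def preRightMul (a : M) : τ.tr.PreGNS →L[ℂ] τ.tr.PreGNS :=
  LinearMap.mkContinuous
    (τ.tr.toPreGNS.toLinearMap ∘ₗ LinearMap.mulRight ℂ a ∘ₗ τ.tr.ofPreGNS.toLinearMap) ‖a‖
    fun x => τ.norm_two_mul_right_le (τ.tr.ofPreGNS x) a

/-- Right multiplication `ξ ↦ ξ a` of elements of `L²(M)` by an element `a` of `M`: the continuous
extension of `x ↦ x a`. -/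
def rightMul (a : M) : τ.L2 →L[ℂ] τ.L2 := (τ.preRightMul a).completion

theorem rightMul_toL2 (a x : M) : τ.rightMul a (τ.toL2 x) = τ.toL2 (x * a) :=
  ContinuousLinearMap.completion_apply_coe (τ.preRightMul a) (τ.tr.toPreGNS x)

/-- The product `(x, y) ↦ x⋆ y`, from `M × M` with the norms `‖·‖₂` to `L¹(M)`. -/
def preStarMul : τ.tr.PreGNS →L⋆[ℂ] τ.tr.PreGNS →L[ℂ] τ.L1 :=
  LinearMap.mkContinuous₂
    (LinearMap.mk₂'ₛₗ (starRingEnd ℂ) (RingHom.id ℂ)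
      (fun x y => τ.toL1 (star (τ.tr.ofPreGNS x) * τ.tr.ofPreGNS y))
      (fun x x' y => by simp [add_mul])
      (fun c x y => by simp)
      (fun x y y' => by simp [mul_add])
      (fun c x y => by simp))
    1 fun x y => by
      rw [one_mul]
      exact (τ.norm_toL1 _).trans_le (τ.norm1_star_mul_le _ _)

/-- The product `(ξ, η) ↦ ξ⋆ η` from `L²(M) × L²(M)` to `L¹(M)`: the continuous extension of the
product `(x, y) ↦ x⋆ y` on `M`. -/
def starMul : τ.L2 →L⋆[ℂ] τ.L2 →L[ℂ] τ.L1 :=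
  ((τ.preStarMul.extend τ.coeL2).flip.extend τ.coeL2).flip

theorem denseRange_coeL2 : DenseRange τ.coeL2 := UniformSpace.Completion.denseRange_coe

theorem isUniformInducing_coeL2 : IsUniformInducing τ.coeL2 :=
  UniformSpace.Completion.isUniformInducing_coe _

theorem starMul_toL2 (x y : M) : τ.starMul (τ.toL2 x) (τ.toL2 y) = τ.toL1 (star x * y) := by
  have h1 := ContinuousLinearMap.extend_eq (τ.preStarMul.extend τ.coeL2).flip
    τ.denseRange_coeL2 τ.isUniformInducing_coeL2 (τ.tr.toPreGNS y)
  have h2 := ContinuousLinearMap.extend_eq τ.preStarMul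
    τ.denseRange_coeL2 τ.isUniformInducing_coeL2 (τ.tr.toPreGNS x)
  exact (congrArg (fun f => f (τ.toL2 x)) h1).trans (congrArg (fun f => f (τ.tr.toPreGNS y)) h2)

/-- `[X S]₂`: the closed linear span in `L²(M)` of the products `x a`, `x ∈ X`, `a ∈ S`. -/
def closedMul (X : Submodule ℂ τ.L2) (S : Set M) : Submodule ℂ τ.L2 :=
  (Submodule.span ℂ {ξ | ∃ x ∈ X, ∃ a ∈ S, τ.rightMul a x = ξ}).topologicalClosure

/-- `L¹(𝒟)` as a subspace of `L¹(M)`: the closure of `𝒟` in `L¹(M)`. -/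
def L1Of (D : Subalgebra ℂ M) : Submodule ℂ τ.L1 :=
  (D.toSubmodule.map τ.toL1).topologicalClosure

/-- `X` is the internal column sum of the subspaces `Xs i`: these are subspaces of `X` which
together densely span `X`, and `(Xs i)⋆ (Xs j) = 0` for `i ≠ j`. -/
structure IsColumnSum {ι : Type*} (X : Submodule ℂ τ.L2) (Xs : ι → Submodule ℂ τ.L2) : Prop where
  le : ∀ i, Xs i ≤ X
  dense : X ≤ (⨆ i, Xs i).topologicalClosure
  starMul_eq_zero : ∀ i j, i ≠ j → ∀ x ∈ Xs i, ∀ y ∈ Xs j, τ.starMul x y = 0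

end

end FaithfulTracialState

/-! ### Von Neumann algebras, weak⋆ topology, normality -/

namespace VonNeumannAlgebra

variable {H : Type*} [NormedAddCommGroup H] [InnerProductSpace ℂ H] [CompleteSpace H]

/-- The elements of a von Neumann algebra on `H`, as a C⋆-algebra (with its spectral order). -/
def Elem (M : VonNeumannAlgebra H) : Type _ := M.toStarSubalgebra

theorem isClosed_toStarSubalgebra (M : VonNeumannAlgebra H) :
    IsClosed (M.toStarSubalgebra : Set (H →L[ℂ] H)) := by
  rw [coe_toStarSubalgebra, ← M.centralizer_centralizer]
  exact Set.isClosed_centralizer _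

variable (M : VonNeumannAlgebra H)

instance : CStarAlgebra M.Elem :=
  haveI : IsClosed (M.toStarSubalgebra : Set (H →L[ℂ] H)) := M.isClosed_toStarSubalgebra
  inferInstanceAs (CStarAlgebra M.toStarSubalgebra)

instance : PartialOrder M.Elem := CStarAlgebra.spectralOrder M.Elem

instance : StarOrderedRing M.Elem := CStarAlgebra.spectralOrderedRing M.Elem

/-- The operator on `H` given by an element of `M`. -/
def Elem.toOp {M : VonNeumannAlgebra H} (x : M.Elem) : H →L[ℂ] H :=
  (show M.toStarSubalgebra from x).1

/-- The weak⋆ (ultraweak) topology of `M`: the coarsest topology for which all the functionals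
`x ↦ ∑ₙ ⟨ηₙ, x ξₙ⟩` with `∑ₙ ‖ξₙ‖² < ∞` and `∑ₙ ‖ηₙ‖² < ∞` are continuous. -/
@[reducible]
def weakStar : TopologicalSpace M.Elem :=
  ⨅ p : lp (fun _ : ℕ => H) 2 × lp (fun _ : ℕ => H) 2,
    TopologicalSpace.induced (fun x : M.Elem => ∑' n, ⟪p.2 n, x.toOp (p.1 n)⟫_ℂ) inferInstance

end VonNeumannAlgebra

namespace FaithfulTracialState

variable {H : Type*} [NormedAddCommGroup H] [InnerProductSpace ℂ H] [CompleteSpace H]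
  {M : VonNeumannAlgebra H} (τ : FaithfulTracialState M.Elem)

/-- Normality of the state `τ`: weak⋆ continuity. -/
def IsNormal : Prop := Continuous[M.weakStar, (inferInstance : TopologicalSpace ℂ)] τ.tr

/-- `Φ` is a faithful normal conditional expectation from `M` onto `𝒟` with `τ ∘ Φ = τ`. -/
structure IsCondExp (D : Subalgebra ℂ M.Elem) (Φ : M.Elem →ₗ[ℂ] M.Elem) : Prop where
  map_mem : ∀ x, Φ x ∈ D
  map_of_mem : ∀ d ∈ D, Φ d = d
  map_nonneg : ∀ x, 0 ≤ x → 0 ≤ Φ x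
  map_mul_mul : ∀ x, ∀ d ∈ D, ∀ e ∈ D, Φ (d * x * e) = d * Φ x * e
  faithful : ∀ x, Φ (star x * x) = 0 → x = 0
  normal : Continuous[M.weakStar, M.weakStar] Φ
  tr_map : ∀ x, τ.tr (Φ x) = τ.tr x

open scoped Classical in
/-- The trace preserving faithful normal conditional expectation from `M` onto `𝒟` (there is at
most one; the value is `0` if there is none). -/
def condExp (D : Subalgebra ℂ M.Elem) : M.Elem →ₗ[ℂ] M.Elem :=
  if h : ∃ Φ, τ.IsCondExp D Φ then h.choose else 0

/-- The diagonal `𝒟 = A ∩ A⋆`. -/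
def diag (A : Subalgebra ℂ M.Elem) : Subalgebra ℂ M.Elem := A ⊓ star A

/-- `A₀ = A ∩ Ker Φ`. -/
def zeroPart (A : Subalgebra ℂ M.Elem) : Submodule ℂ M.Elem :=
  A.toSubmodule ⊓ LinearMap.ker (τ.condExp (diag A))

/-- Tracial subalgebras of `M`: weak⋆ closed unital subalgebras `A` on which the trace preserving
faithful normal conditional expectation from `M` onto `A ∩ A⋆` is multiplicative. -/
structure IsTracialSubalgebra (A : Subalgebra ℂ M.Elem) : Prop where
  isClosed : IsClosed[M.weakStar] (A : Set M.Elem)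
  exists_condExp_map_mul : ∃ Φ : M.Elem →ₗ[ℂ] M.Elem, τ.IsCondExp (diag A) Φ ∧
    ∀ a ∈ A, ∀ b ∈ A, Φ (a * b) = Φ a * Φ b

/-- Maximal subdiagonal algebras: tracial subalgebras `A` with `A + A⋆` weak⋆ dense in `M`. -/
structure IsMaximalSubdiagonal (A : Subalgebra ℂ M.Elem) : Prop extends
    τ.IsTracialSubalgebra A where
  dense : @Dense _ M.weakStar {x : M.Elem | ∃ a ∈ A, ∃ b ∈ A, x = a + star b}

/-- (Right) `A`-invariant subspaces of `L²(M)`: closed subspaces `K` with `K A ⊆ K`. -/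
structure IsInvariant (A : Subalgebra ℂ M.Elem) (K : Submodule ℂ τ.L2) : Prop where
  isClosed : IsClosed (K : Set τ.L2)
  rightMul_mem : ∀ x ∈ K, ∀ a ∈ A, τ.rightMul a x ∈ K

/-- Simply invariant subspaces: invariant subspaces `K` with `[K A₀]₂` properly contained
in `K`. -/
structure IsSimplyInvariant (A : Subalgebra ℂ M.Elem) (K : Submodule ℂ τ.L2) : Prop extends
    τ.IsInvariant A K where
  lt : τ.closedMul K (τ.zeroPart A) < K

/-- The right wandering subspace `K ⊖ [K A₀]₂`. -/
def wandering (A : Subalgebra ℂ M.Elem) (K : Submodule ℂ τ.L2) : Submodule ℂ τ.L2 :=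
  K ⊓ (τ.closedMul K (τ.zeroPart A))ᗮ

/-- Type 2 invariant subspaces: the right wandering subspace is zero. -/
structure IsTypeTwo (A : Subalgebra ℂ M.Elem) (K : Submodule ℂ τ.L2) : Prop extends
    τ.IsInvariant A K where
  wandering_eq_bot : τ.wandering A K = ⊥

/-- `X = Z ⊕ᶜᵒˡ [Y A]₂` with `Z`, `Y` closed subspaces of `X`, `Z` a type 2 invariant subspace and
`Y⋆ Y ⊆ L¹(𝒟)`. -/
structure IsDecomposition (A : Subalgebra ℂ M.Elem) (X Z Y : Submodule ℂ τ.L2) : Prop where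
  left_le : Z ≤ X
  right_le : Y ≤ X
  isClosed_right : IsClosed (Y : Set τ.L2)
  isTypeTwo : τ.IsTypeTwo A Z
  starMul_mem : ∀ y ∈ Y, ∀ x ∈ Y, τ.starMul y x ∈ τ.L1Of (diag A)
  isColumnSum : τ.IsColumnSum X ![Z, τ.closedMul Y A]

/-- `Y` is a right `𝒟`-submodule of `L²(M)`. -/
def IsDiagSubmodule (A : Subalgebra ℂ M.Elem) (Y : Submodule ℂ τ.L2) : Prop :=
  ∀ y ∈ Y, ∀ d ∈ diag A, τ.rightMul d y ∈ Y

end FaithfulTracialState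

end

noncomputable section

/-! ### The pairing of `L¹(M)` with `M` and conditional expectations -/

namespace FaithfulTracialState

section Pairing

variable {M : Type*} [CStarAlgebra M] [PartialOrder M] [StarOrderedRing M]
  (τ : FaithfulTracialState M)

/-! The functionals `f ↦ τ(f b)`, `b ∈ M`, separate `L¹(M)`, and on a product `ξ⋆ η` they take the
value `⟪ξ, η b⟫`. So both conditions on products become Hilbert space statements: `ξ⋆ η = 0` means
`ξ ⟂ η M`, and `ξ⋆ η ∈ L¹(𝒟)` means `⟪ξ, η b⟫ = ⟪ξ, η Φ(b)⟫` for all `b` (`starMul_eq_zero_iff`,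
`starMul_mem_L1Of_iff`).

Claims 1–4: `Y⋆ Y ⊆ L¹(𝒟)` makes `Y 𝒟` orthogonal to `Y A₀`. With `A = 𝒟 + A₀`, `A A₀ ⊆ A₀` and `Z =
[Z A₀]₂` this gives the orthogonal sum `X = [X A₀]₂ ⊕ [Y 𝒟]₂`. Thus `[Y 𝒟]₂` is the wandering
subspace of `X`, which depends on `X` alone, and `Z` is the complement in `X` of `[Y A]₂ = [[Y 𝒟]₂
A]₂`.

Claim 5: take `Z = X ⊖ [Y A]₂`. For normal `τ` the functions `b ↦ ⟪ξ, η b⟫` are weak⋆ continuous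
(`IsNormal.continuous_inner_rightMul`), so the identities above need checking only on `A + A⋆`,
where they follow from orthogonality to `A₀`-multiples. The continuity is obtained by writing `τ` as
a vector functional of an amplification of the identity representation. -/

theorem denseRange_toL2 : DenseRange τ.toL2 := τ.denseRange_coeL2

theorem denseRange_toL1 : DenseRange τ.toL1 :=
  UniformSpace.Completion.denseRange_coe (α := τ.PreL1)

theorem inner_toL2 (x y : M) : ⟪τ.toL2 x, τ.toL2 y⟫_ℂ = τ.tr (star x * y) :=
  UniformSpace.Completion.inner_coe (τ.tr.toPreGNS x) (τ.tr.toPreGNS y)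

theorem norm_toL2_star (x : M) : ‖τ.toL2 (star x)‖ = ‖τ.toL2 x‖ :=
  (UniformSpace.Completion.norm_coe (τ.tr.toPreGNS (star x))).trans
    ((τ.norm_two_star x).trans (UniformSpace.Completion.norm_coe (τ.tr.toPreGNS x)).symm)

theorem rightMul_rightMul (a b : M) (ξ : τ.L2) :
    τ.rightMul b (τ.rightMul a ξ) = τ.rightMul (a * b) ξ := by
  refine τ.denseRange_toL2.induction_on ξ (isClosed_eq (by fun_prop) (by fun_prop)) fun x => ?_
  simp only [rightMul_toL2, mul_assoc]

theorem rightMul_one (ξ : τ.L2) : τ.rightMul 1 ξ = ξ := by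
  refine τ.denseRange_toL2.induction_on ξ (isClosed_eq (by fun_prop) (by fun_prop)) fun x => ?_
  rw [rightMul_toL2, mul_one]

theorem rightMul_add (a b : M) (ξ : τ.L2) :
    τ.rightMul (a + b) ξ = τ.rightMul a ξ + τ.rightMul b ξ := by
  refine τ.denseRange_toL2.induction_on ξ (isClosed_eq (by fun_prop) (by fun_prop)) fun x => ?_
  simp only [rightMul_toL2, mul_add, map_add]

theorem rightMul_zero (ξ : τ.L2) : τ.rightMul 0 ξ = 0 := by
  simpa using τ.rightMul_add 0 0 ξ

/-- Right multiplication by `a` is adjoint to right multiplication by `a⋆`. -/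
theorem inner_rightMul_left (a : M) (ξ η : τ.L2) :
    ⟪τ.rightMul a ξ, η⟫_ℂ = ⟪ξ, τ.rightMul (star a) η⟫_ℂ := by
  refine τ.denseRange_toL2.induction_on₂
    (p := fun ξ η => ⟪τ.rightMul a ξ, η⟫_ℂ = ⟪ξ, τ.rightMul (star a) η⟫_ℂ)
    (isClosed_eq (by fun_prop) (by fun_prop)) (fun x y => ?_) ξ η
  rw [rightMul_toL2, rightMul_toL2, inner_toL2, inner_toL2, star_mul, mul_assoc, tr_mul_comm,
    mul_assoc]

/-- The functional `f ↦ τ(f b)` on `L¹(M)`, for `b ∈ M`. -/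
def pairing (b : M) : τ.L1 →L[ℂ] ℂ :=
  (τ.tr.toLinearMap ∘ₗ LinearMap.mulRight ℂ b).extendOfNorm τ.toL1

theorem pairing_toL1 (b x : M) : τ.pairing b (τ.toL1 x) = τ.tr (x * b) :=
  LinearMap.extendOfNorm_eq τ.denseRange_toL1
    ⟨‖b‖, fun x => by rw [norm_toL1]; exact τ.norm_tr_mul_le_norm1 x b⟩ x

theorem norm_pairing_le (b : M) (f : τ.L1) : ‖τ.pairing b f‖ ≤ ‖b‖ * ‖f‖ :=
  LinearMap.norm_extendOfNorm_apply_le τ.denseRange_toL1 ‖b‖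
    (fun x => by rw [norm_toL1]; exact τ.norm_tr_mul_le_norm1 x b) f

/-- Approximate `f` by some `x ∈ M` and pair with an `a` in the unit ball that almost attains
`‖x‖₁`; each of the three errors costs `ε / 3`. -/
theorem eq_zero_of_pairing_eq_zero {f : τ.L1} (h : ∀ b, τ.pairing b f = 0) : f = 0 := by
  rw [← norm_le_zero_iff]
  refine le_of_forall_pos_le_add fun ε hε => ?_
  obtain ⟨x, hx⟩ := τ.denseRange_toL1.exists_dist_lt f (by positivity : 0 < ε / 3)
  obtain ⟨a, ha, hxa⟩ := τ.exists_norm1_le x (by positivity : 0 < ε / 3)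
  rw [dist_eq_norm] at hx
  have h1 : ‖τ.tr (x * a)‖ ≤ ε / 3 := by
    rw [← pairing_toL1, ← norm_neg, ← zero_sub, ← h a, ← map_sub]
    exact (τ.norm_pairing_le a _).trans
      ((mul_le_of_le_one_left (norm_nonneg _) ha).trans hx.le)
  have h2 : ‖f‖ ≤ ‖f - τ.toL1 x‖ + ‖τ.toL1 x‖ := by
    simpa using norm_add_le (f - τ.toL1 x) (τ.toL1 x)
  rw [norm_toL1] at h2
  linarith

theorem ext_pairing {f g : τ.L1} (h : ∀ b, τ.pairing b f = τ.pairing b g) : f = g :=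
  sub_eq_zero.1 <| τ.eq_zero_of_pairing_eq_zero fun b => by rw [map_sub, h, sub_self]

/-- `τ((ξ⋆ η) b) = ⟪ξ, η b⟫`. -/
theorem pairing_starMul (b : M) (ξ η : τ.L2) :
    τ.pairing b (τ.starMul ξ η) = ⟪ξ, τ.rightMul b η⟫_ℂ := by
  refine τ.denseRange_toL2.induction_on₂
    (p := fun ξ η => τ.pairing b (τ.starMul ξ η) = ⟪ξ, τ.rightMul b η⟫_ℂ)
    (isClosed_eq (by fun_prop) (by fun_prop)) (fun x y => ?_) ξ η
  rw [starMul_toL2, pairing_toL1, rightMul_toL2, inner_toL2, mul_assoc]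

theorem starMul_eq_zero_iff {ξ η : τ.L2} :
    τ.starMul ξ η = 0 ↔ ∀ b, ⟪ξ, τ.rightMul b η⟫_ℂ = 0 := by
  refine ⟨fun h b => ?_, fun h => τ.eq_zero_of_pairing_eq_zero fun b => ?_⟩
  · rw [← pairing_starMul, h, map_zero]
  · rw [pairing_starMul, h]

theorem inner_eq_zero_of_starMul_eq_zero {ξ η : τ.L2} (h : τ.starMul ξ η = 0) :
    ⟪ξ, η⟫_ℂ = 0 := by
  simpa [rightMul_one] using τ.starMul_eq_zero_iff.1 h 1

end Pairing

/-! ### Conditional expectations and the subspace `L¹(𝒟)` -/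

section CondExp

variable {H : Type*} [NormedAddCommGroup H] [InnerProductSpace ℂ H] [CompleteSpace H]
  {M : VonNeumannAlgebra H} {τ : FaithfulTracialState M.Elem}
  {D A : Subalgebra ℂ M.Elem} {Φ Ψ : M.Elem →ₗ[ℂ] M.Elem}

namespace IsCondExp

theorem map_mul_left (h : τ.IsCondExp D Φ) {d : M.Elem} (hd : d ∈ D) (x : M.Elem) :
    Φ (d * x) = d * Φ x := by
  simpa using h.map_mul_mul x d hd 1 D.one_mem

theorem map_mul_right (h : τ.IsCondExp D Φ) {d : M.Elem} (hd : d ∈ D) (x : M.Elem) :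
    Φ (x * d) = Φ x * d := by
  simpa using h.map_mul_mul x 1 D.one_mem d hd

theorem map_map (h : τ.IsCondExp D Φ) (x : M.Elem) : Φ (Φ x) = Φ x :=
  h.map_of_mem _ (h.map_mem x)

/-- `Φ` as a positive linear map. -/
def toPositive (h : τ.IsCondExp D Φ) : M.Elem →ₚ[ℂ] M.Elem := .mk₀ Φ h.map_nonneg

theorem map_star (h : τ.IsCondExp D Φ) (x : M.Elem) : Φ (star x) = star (Φ x) :=
  StarHomClass.map_star h.toPositive x

theorem exists_norm_le (h : τ.IsCondExp D Φ) : ∃ C, ∀ x, ‖Φ x‖ ≤ C * ‖x‖ := by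
  obtain ⟨C, hC⟩ := h.toPositive.exists_norm_apply_le
  exact ⟨C, hC⟩

/-- Both sides equal `τ(Φ(x) Φ(y))`. -/
theorem tr_mul_map (h : τ.IsCondExp D Φ) (x y : M.Elem) :
    τ.tr (x * Φ y) = τ.tr (Φ x * y) := by
  rw [← h.tr_map (x * Φ y), ← h.tr_map (Φ x * y), h.map_mul_right (h.map_mem y),
    h.map_mul_left (h.map_mem x)]

/-- With `d = Φ(x) - Ψ(x) ∈ D`, both `τ(d⋆ Φ(x))` and `τ(d⋆ Ψ(x))` equal `τ(d⋆ x)`, so `τ(d⋆ d) =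
0`. This transfers multiplicativity on `A` to the chosen expectation `condExp`. -/
theorem unique (hD : ∀ d ∈ D, star d ∈ D) (h : τ.IsCondExp D Φ) (h' : τ.IsCondExp D Ψ) :
    Φ = Ψ := by
  ext x
  have hmem : Φ x - Ψ x ∈ D := D.sub_mem (h.map_mem x) (h'.map_mem x)
  refine sub_eq_zero.1 (τ.faithful' _ ?_)
  change τ.tr _ = 0
  have e1 : star (Φ x - Ψ x) * Φ x = Φ (star (Φ x - Ψ x) * x) :=
    (h.map_mul_left (hD _ hmem) x).symm
  have e2 : star (Φ x - Ψ x) * Ψ x = Ψ (star (Φ x - Ψ x) * x) :=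
    (h'.map_mul_left (hD _ hmem) x).symm
  rw [mul_sub, e1, e2, map_sub, h.tr_map, h'.tr_map, sub_self]

/-- Duality: `τ(Φ(x) a) = τ(x Φ(a))`, so boundedness in the norm of `M` gives boundedness in `‖·‖₁`.
-/
theorem exists_norm1_map_le (h : τ.IsCondExp D Φ) :
    ∃ C, ∀ x, ‖τ.toL1 (Φ x)‖ ≤ C * ‖τ.toL1 x‖ := by
  obtain ⟨C, hC⟩ := h.exists_norm_le
  refine ⟨|C|, fun x => ?_⟩
  rw [norm_toL1, norm_toL1]
  refine le_of_forall_pos_le_add fun ε hε => ?_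
  obtain ⟨a, ha, hxa⟩ := τ.exists_norm1_le (Φ x) hε
  refine hxa.trans (add_le_add_left ?_ ε)
  rw [← h.tr_mul_map]
  refine (τ.norm_tr_mul_le_norm1 _ _).trans
    (mul_le_mul_of_nonneg_right ?_ (τ.norm1_nonneg x))
  calc ‖Φ a‖ ≤ C * ‖a‖ := hC a
    _ ≤ |C| * ‖a‖ := mul_le_mul_of_nonneg_right (le_abs_self C) (norm_nonneg a)
    _ ≤ |C| := mul_le_of_le_one_right (abs_nonneg C) ha

/-- `L¹(𝒟)` consists of the `f` with `τ(f b) = τ(f Φ(b))` for all `b ∈ M`. -/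
theorem mem_L1Of_iff (h : τ.IsCondExp D Φ) {f : τ.L1} :
    f ∈ τ.L1Of D ↔ ∀ b, τ.pairing b f = τ.pairing (Φ b) f := by
  constructor
  · intro hf b
    have hcl : IsClosed {f : τ.L1 | τ.pairing b f = τ.pairing (Φ b) f} :=
      isClosed_eq (by fun_prop) (by fun_prop)
    refine closure_minimal ?_ hcl hf
    rintro _ ⟨d, hd, rfl⟩
    change τ.pairing b (τ.toL1 d) = τ.pairing (Φ b) (τ.toL1 d)
    rw [pairing_toL1, pairing_toL1, ← h.tr_map, h.map_mul_left hd]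
  · intro hf
    -- Extend `Φ` to `L¹(M)`: the range of the extension lies in `L¹(𝒟)`, and the hypothesis says
    -- that `f` and its image have the same pairings.
    set Φ₁ : τ.L1 →L[ℂ] τ.L1 := (τ.toL1 ∘ₗ Φ).extendOfNorm τ.toL1
    have hΦ₁ : ∀ x, Φ₁ (τ.toL1 x) = τ.toL1 (Φ x) :=
      LinearMap.extendOfNorm_eq τ.denseRange_toL1 h.exists_norm1_map_le
    have hmem : ∀ g, Φ₁ g ∈ τ.L1Of D := fun g => by
      refine τ.denseRange_toL1.induction_on g
        ((Submodule.isClosed_topologicalClosure _).preimage Φ₁.continuous) fun x => ?_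
      rw [hΦ₁]
      exact Submodule.le_topologicalClosure _ ⟨Φ x, h.map_mem x, rfl⟩
    have hpair : ∀ b g, τ.pairing b (Φ₁ g) = τ.pairing (Φ b) g := fun b g => by
      refine τ.denseRange_toL1.induction_on g
        (isClosed_eq (by fun_prop) (by fun_prop)) fun x => ?_
      rw [hΦ₁, pairing_toL1, pairing_toL1, h.tr_mul_map]
    rw [τ.ext_pairing fun b => (hf b).trans (hpair b f).symm]
    exact hmem f

theorem starMul_mem_L1Of_iff (h : τ.IsCondExp D Φ) {ξ η : τ.L2} :
    τ.starMul ξ η ∈ τ.L1Of D ↔ ∀ b, ⟪ξ, τ.rightMul b η⟫_ℂ = ⟪ξ, τ.rightMul (Φ b) η⟫_ℂ := by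
  simp only [h.mem_L1Of_iff, pairing_starMul]

end IsCondExp

theorem star_mem_diag {d : M.Elem} (hd : d ∈ diag A) : star d ∈ diag A :=
  ⟨hd.2, by simpa [Subalgebra.mem_star_iff] using hd.1⟩

theorem diag_le : diag A ≤ A := inf_le_left

namespace IsTracialSubalgebra

theorem isCondExp (hA : τ.IsTracialSubalgebra A) : τ.IsCondExp (diag A) (τ.condExp (diag A)) := by
  obtain ⟨Φ, hΦ, -⟩ := hA.exists_condExp_map_mul
  have h : ∃ Φ, τ.IsCondExp (diag A) Φ := ⟨Φ, hΦ⟩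
  rw [condExp, dif_pos h]
  exact h.choose_spec

theorem condExp_mul (hA : τ.IsTracialSubalgebra A) {a b : M.Elem} (ha : a ∈ A) (hb : b ∈ A) :
    τ.condExp (diag A) (a * b) = τ.condExp (diag A) a * τ.condExp (diag A) b := by
  obtain ⟨Φ, hΦ, hmul⟩ := hA.exists_condExp_map_mul
  rw [← IsCondExp.unique (fun _ => star_mem_diag) hΦ hA.isCondExp]
  exact hmul a ha b hb

theorem mul_mem_zeroPart (hA : τ.IsTracialSubalgebra A) {a b : M.Elem} (ha : a ∈ A)
    (hb : b ∈ τ.zeroPart A) : a * b ∈ τ.zeroPart A := by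
  refine ⟨A.mul_mem ha hb.1, LinearMap.mem_ker.2 ?_⟩
  rw [hA.condExp_mul ha hb.1, LinearMap.mem_ker.1 hb.2, mul_zero]

theorem sub_condExp_mem (hA : τ.IsTracialSubalgebra A) {a : M.Elem} (ha : a ∈ A) :
    a - τ.condExp (diag A) a ∈ τ.zeroPart A := by
  refine ⟨A.sub_mem ha (diag_le (hA.isCondExp.map_mem a)), LinearMap.mem_ker.2 ?_⟩
  rw [map_sub, hA.isCondExp.map_map, sub_self]

end IsTracialSubalgebra

end CondExp

end FaithfulTracialState

/-! ### Amplifications and dominated traces -/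

theorem lp.norm_sq_eq_sum {G J : Type*} [NormedAddCommGroup G] [Fintype J]
    (f : lp (fun _ : J => G) 2) : ‖f‖ ^ 2 = ∑ j, ‖f j‖ ^ 2 := by
  have := lp.norm_rpow_eq_tsum (by simp) f
  simpa [tsum_fintype] using this

section Amplification

variable {G : Type*} [NormedAddCommGroup G] [InnerProductSpace ℂ G] {J : Type*}

theorem Memℓp.clm_comp (T : G →L[ℂ] G) {f : J → G} (hf : Memℓp f 2) :
    Memℓp (fun i => T (f i)) 2 := by
  refine memℓp_gen (.of_nonneg_of_le (fun i => by positivity) (fun i => ?_)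
    (((memℓp_gen_iff (by simp)).1 hf).mul_left (‖T‖ ^ (2 : ENNReal).toReal)))
  rw [← Real.mul_rpow (norm_nonneg _) (norm_nonneg _)]
  exact Real.rpow_le_rpow (norm_nonneg _) (T.le_opNorm _) (by simp)

/-- The diagonal operator `(ξ_i) ↦ (T ξ_i)` on the Hilbert sum of copies of `G`. -/
def lpDiagonal (T : G →L[ℂ] G) : lp (fun _ : J => G) 2 →L[ℂ] lp (fun _ : J => G) 2 :=
  LinearMap.mkContinuous
    { toFun := fun f => ⟨fun i => T (f i), (lp.memℓp f).clm_comp T⟩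
      map_add' := fun f g => by ext i; exact map_add T _ _
      map_smul' := fun c f => by ext i; exact map_smul T _ _ } ‖T‖ fun f => by
    have h : 0 < (2 : ENNReal).toReal := by simp
    refine lp.norm_le_of_tsum_le h (by positivity) ?_
    rw [Real.mul_rpow (norm_nonneg _) (norm_nonneg _), lp.norm_rpow_eq_tsum h, ← tsum_mul_left]
    refine ((memℓp_gen_iff h).1 ((lp.memℓp f).clm_comp T)).tsum_le_tsum (fun i => ?_)
      (((memℓp_gen_iff h).1 (lp.memℓp f)).mul_left _)
    rw [← Real.mul_rpow (norm_nonneg _) (norm_nonneg _)]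
    exact Real.rpow_le_rpow (norm_nonneg _) (T.le_opNorm _) h.le

@[simp]
theorem lpDiagonal_apply (T : G →L[ℂ] G) (f : lp (fun _ : J => G) 2) (i : J) :
    lpDiagonal T f i = T (f i) := rfl

variable [CompleteSpace G]

/-- Amplification of operators on `G` to the Hilbert sum of copies of `G`. -/
def amplification : (G →L[ℂ] G) →⋆ₐ[ℂ] (lp (fun _ : J => G) 2 →L[ℂ] lp (fun _ : J => G) 2) where
  toFun := lpDiagonal
  map_one' := by ext f i; simp
  map_mul' S T := by ext f i; simp
  map_zero' := by ext f i; simp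
  map_add' S T := by ext f i; simp
  commutes' c := by ext f i; simp [Algebra.algebraMap_eq_smul_one]
  map_star' T := by
    refine (ContinuousLinearMap.eq_adjoint_iff _ _).2 fun f g => ?_
    simp only [lp.inner_eq_tsum, lpDiagonal_apply, ContinuousLinearMap.star_eq_adjoint,
      ContinuousLinearMap.adjoint_inner_left]

end Amplification

section Dominated

variable {M : Type*} [CStarAlgebra M]
  {E : Type*} [NormedAddCommGroup E] [InnerProductSpace ℂ E] [CompleteSpace E]
  (ρ : M →⋆ₐ[ℂ] (E →L[ℂ] E)) (ζ : E)

namespace FaithfulTracialState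

/-- The orbit map `b ↦ ρ(b) ζ` of a representation. -/
def orbitMap : M →ₗ[ℂ] E :=
  (ContinuousLinearMap.apply ℂ E ζ).toLinearMap ∘ₗ ρ.toAlgHom.toLinearMap

@[simp]
theorem orbitMap_apply (b : M) : orbitMap ρ ζ b = ρ b ζ := rfl

theorem inner_map_left (b : M) (u v : E) : ⟪ρ b u, v⟫_ℂ = ⟪u, ρ (star b) v⟫_ℂ := by
  rw [map_star, ContinuousLinearMap.star_eq_adjoint, ContinuousLinearMap.adjoint_inner_right]

/-- The orbit of `ζ` is invariant under a self-adjoint family of operators, so its complement is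
invariant too. -/
theorem map_mem_orthogonal_range (b : M) {v : E} (hv : v ∈ (LinearMap.range (orbitMap ρ ζ))ᗮ) :
    ρ b v ∈ (LinearMap.range (orbitMap ρ ζ))ᗮ := by
  rw [Submodule.mem_orthogonal] at hv ⊢
  rintro _ ⟨c, rfl⟩
  have := hv (orbitMap ρ ζ (star b * c)) ⟨_, rfl⟩
  rwa [orbitMap_apply, map_mul, mul_apply_eq_comp, inner_map_left, star_star] at this

variable [PartialOrder M] [StarOrderedRing M] {τ : FaithfulTracialState M} {ρ ζ}

/-- If `τ(b⋆ b) ≤ ‖ρ(b) ζ‖²` then there is an intertwiner from `ρ` to the GNS representation of `τ`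
which maps `ζ` to the trace vector. -/
theorem exists_intertwiner (h : ∀ b, ‖τ.toL2 b‖ ≤ ‖ρ b ζ‖) :
    ∃ V : E →L[ℂ] τ.L2, (∀ b, V (ρ b ζ) = τ.toL2 b) ∧
      ∀ b v, V (ρ b v) = τ.tr.gnsStarAlgHom b (V v) := by
  set K := LinearMap.range (orbitMap ρ ζ)
  -- `V` is prescribed as `ρ(b) ζ + v ↦ b` on the dense subspace `K + Kᗮ`, hence zero on `Kᗮ`;
  -- Pythagoras gives the bound.
  let e : M × Kᗮ →ₗ[ℂ] E := (orbitMap ρ ζ).coprod Kᗮ.subtype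
  let f : M × Kᗮ →ₗ[ℂ] τ.L2 := τ.toL2 ∘ₗ LinearMap.fst ℂ M Kᗮ
  have he : DenseRange e := by
    have h1 : LinearMap.range e = K ⊔ Kᗮ := by
      rw [LinearMap.range_coprod, Submodule.range_subtype]
    have h2 : (K ⊔ Kᗮ).topologicalClosure = ⊤ := by
      rw [Submodule.topologicalClosure_eq_top_iff, ← Submodule.inf_orthogonal,
        Submodule.inf_orthogonal_eq_bot]
    have := Submodule.dense_iff_topologicalClosure_eq_top.2 h2
    rwa [← h1] at this
  have hn : ∃ C, ∀ x, ‖f x‖ ≤ C * ‖e x‖ := by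
    refine ⟨1, fun ⟨b, v⟩ => ?_⟩
    rw [one_mul]
    refine (h b).trans ?_
    have hv : ⟪ρ b ζ, (v : E)⟫_ℂ = 0 := v.2 _ ⟨b, rfl⟩
    have := norm_add_sq_eq_norm_sq_add_norm_sq_of_inner_eq_zero _ _ hv
    refine abs_le_of_sq_le_sq' ?_ (norm_nonneg _) |>.2
    change _ ≤ ‖ρ b ζ + v‖ ^ 2
    nlinarith [mul_self_nonneg ‖(v : E)‖]
  have hV : ∀ x, f.extendOfNorm e (e x) = f x := LinearMap.extendOfNorm_eq he hn
  refine ⟨f.extendOfNorm e, fun b => ?_, fun b v => ?_⟩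
  · simpa [e, f] using hV (b, 0)
  · refine he.induction_on v (isClosed_eq (by fun_prop) (by fun_prop)) fun ⟨c, w⟩ => ?_
    have h1 : ρ b (e (c, w)) = e (b * c, ⟨ρ b w, map_mem_orthogonal_range ρ ζ b w.2⟩) := by
      simp [e]
    rw [h1, hV, hV]
    exact (PositiveLinearMap.gnsNonUnitalStarAlgHom_apply_coe (f := τ.tr) (a := b)
      (b := τ.tr.toPreGNS c)).symm

/-- A trace dominated by a vector functional of `ρ` is itself a vector functional of `ρ`. -/
theorem exists_inner_eq (h : ∀ b, ‖τ.toL2 b‖ ≤ ‖ρ b ζ‖) :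
    ∃ θ : E, ∀ x y, ⟪ρ x θ, ρ y θ⟫_ℂ = τ.tr (star x * y) := by
  obtain ⟨V, hVζ, hV⟩ := exists_intertwiner h
  -- `P = V⋆ V` commutes with `ρ`, hence so does its square root; therefore `ρ(b) √P ζ = √P ρ(b) ζ`,
  -- and `θ = √P ζ` represents the trace.
  set P : E →L[ℂ] E := ContinuousLinearMap.adjoint V ∘SL V with hP
  have hP0 : 0 ≤ P := (ContinuousLinearMap.nonneg_iff_isPositive _).2
    (ContinuousLinearMap.isPositive_adjoint_comp_self V)
  have hinner : ∀ u v, ⟪u, P v⟫_ℂ = ⟪V u, V v⟫_ℂ := fun u v => by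
    rw [hP, ContinuousLinearMap.comp_apply, ContinuousLinearMap.adjoint_inner_right]
  have hcomm : ∀ b, Commute P (ρ b) := fun b => by
    ext v
    refine ext_inner_left ℂ fun u => ?_
    rw [mul_apply_eq_comp, mul_apply_eq_comp, hinner,
      ← star_star b, ← inner_map_left, hinner, star_star, hV, hV, inner_map_left, star_star]
  have hS : ∀ b, Commute (CFC.sqrt P) (ρ b) := fun b => (hcomm b).cfcₙ_nnreal _
  have hSS : ∀ u v, ⟪CFC.sqrt P u, CFC.sqrt P v⟫_ℂ = ⟪V u, V v⟫_ℂ := fun u v => by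
    have hsa : IsSelfAdjoint (CFC.sqrt P) := (CFC.sqrt_nonneg P).isSelfAdjoint
    rw [← hinner, ← ContinuousLinearMap.adjoint_inner_right, hsa.adjoint_eq,
      ← mul_apply_eq_comp, CFC.sqrt_mul_sqrt_self P]
  refine ⟨CFC.sqrt P ζ, fun x y => ?_⟩
  have hc : ∀ b, ρ b (CFC.sqrt P ζ) = CFC.sqrt P (ρ b ζ) := fun b =>
    congrArg (fun T : E →L[ℂ] E => T ζ) (hS b).symm.eq
  rw [hc, hc, hSS, hVζ, hVζ, inner_toL2]

/-- The functionals `b ↦ ⟪ξ, η b⟫`, with `ξ, η ∈ L²(M)`, are coefficients of `ρ`. -/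
theorem exists_inner_rightMul_eq (h : ∀ b, ‖τ.toL2 b‖ ≤ ‖ρ b ζ‖) (ξ η : τ.L2) :
    ∃ u v : E, ∀ b, ⟪ξ, τ.rightMul b η⟫_ℂ = ⟪u, ρ b v⟫_ℂ := by
  obtain ⟨θ, hθ⟩ := exists_inner_eq h
  -- The adjoint in `x ↦ ρ(x⋆) θ` turns right multiplication into the left action of `ρ`. The map is
  -- isometric for `‖·‖₂` by traciality, and being antilinear it swaps `ξ` and `η` below.
  let f : M →ₗ⋆[ℂ] E :=
    { toFun := fun x => ρ (star x) θ
      map_add' := fun x y => by simp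
      map_smul' := fun c x => by simp }
  have hf : ∃ C, ∀ x, ‖f x‖ ≤ C * ‖τ.toL2 x‖ := by
    refine ⟨1, fun x => ?_⟩
    rw [one_mul, ← τ.norm_toL2_star, ← sq_le_sq₀ (norm_nonneg _) (norm_nonneg _),
      ← inner_self_eq_norm_sq (𝕜 := ℂ), ← inner_self_eq_norm_sq (𝕜 := ℂ), inner_toL2]
    exact (congrArg _ (hθ (star x) (star x))).le
  have hW : ∀ x, f.extendOfNorm τ.toL2 (τ.toL2 x) = f x :=
    LinearMap.extendOfNorm_eq τ.denseRange_toL2 hf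
  refine ⟨f.extendOfNorm τ.toL2 η, f.extendOfNorm τ.toL2 ξ, fun b => ?_⟩
  refine τ.denseRange_toL2.induction_on₂
    (p := fun ξ η => ⟪ξ, τ.rightMul b η⟫_ℂ =
      ⟪f.extendOfNorm τ.toL2 η, ρ b (f.extendOfNorm τ.toL2 ξ)⟫_ℂ)
    (isClosed_eq (by fun_prop) (by fun_prop)) (fun x y => ?_) ξ η
  rw [hW, hW, rightMul_toL2, inner_toL2]
  change _ = ⟪ρ (star y) θ, ρ b (ρ (star x) θ)⟫_ℂ
  rw [← mul_apply_eq_comp, ← map_mul, hθ, star_star, ← mul_assoc, tr_mul_comm,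
    ← mul_assoc, tr_mul_comm]

end FaithfulTracialState

end Dominated

/-! ### Weak⋆ continuity of the coefficients of the right action -/

namespace VonNeumannAlgebra

variable {H : Type*} [NormedAddCommGroup H] [InnerProductSpace ℂ H] [CompleteSpace H]
  (M : VonNeumannAlgebra H)

/-- The identity representation of `M` on `H`. -/
def toOpHom : M.Elem →⋆ₐ[ℂ] (H →L[ℂ] H) := M.toStarSubalgebra.subtype

/-- The infinite amplification of the identity representation. -/
def infAmplification :
    M.Elem →⋆ₐ[ℂ] (lp (fun _ : ℕ => H) 2 →L[ℂ] lp (fun _ : ℕ => H) 2) :=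
  amplification.comp M.toOpHom

/-- The functional `x ↦ ∑ₙ ⟨ηₙ, x ξₙ⟩`. -/
def normalFunctional (p : lp (fun _ : ℕ => H) 2 × lp (fun _ : ℕ => H) 2) : M.Elem →ₗ[ℂ] ℂ :=
  (innerSL ℂ p.2).toLinearMap ∘ₗ FaithfulTracialState.orbitMap M.infAmplification p.1

theorem normalFunctional_apply (p : lp (fun _ : ℕ => H) 2 × lp (fun _ : ℕ => H) 2) (x : M.Elem) :
    M.normalFunctional p x = ⟪p.2, M.infAmplification x p.1⟫_ℂ := rfl

theorem weakStar_eq : M.weakStar =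
    ⨅ p, TopologicalSpace.induced (M.normalFunctional p) inferInstance := by
  refine iInf_congr fun p => ?_
  congr 1

theorem continuous_normalFunctional (p : lp (fun _ : ℕ => H) 2 × lp (fun _ : ℕ => H) 2) :
    Continuous[M.weakStar, inferInstance] (M.normalFunctional p) := by
  rw [weakStar_eq]
  exact continuous_iInf_dom continuous_induced_dom

theorem continuous_sum_normalFunctional {J : Type*} [Fintype J]
    (p : J → lp (fun _ : ℕ => H) 2 × lp (fun _ : ℕ => H) 2) :
    Continuous[M.weakStar, inferInstance] fun x => ∑ j, M.normalFunctional (p j) x := by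
  let _ := M.weakStar
  exact continuous_finsetSum _ fun j _ => M.continuous_normalFunctional (p j)

end VonNeumannAlgebra

namespace FaithfulTracialState

variable {H : Type*} [NormedAddCommGroup H] [InnerProductSpace ℂ H] [CompleteSpace H]
  {M : VonNeumannAlgebra H} {τ : FaithfulTracialState M.Elem}

/-- Move `b⋆` to the other side of the inner product, then apply Cauchy–Schwarz and the
arithmetic–geometric mean inequality. No positivity of the functional is needed. -/
theorem norm_normalFunctional_star_mul_self_le
    (p : lp (fun _ : ℕ => H) 2 × lp (fun _ : ℕ => H) 2) (b : M.Elem) :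
    ‖M.normalFunctional p (star b * b)‖ ≤
      ‖M.infAmplification b p.1‖ ^ 2 + ‖M.infAmplification b p.2‖ ^ 2 := by
  rw [M.normalFunctional_apply, map_mul, mul_apply_eq_comp, ← inner_map_left]
  refine (norm_inner_le_norm _ _).trans ?_
  nlinarith [sq_nonneg (‖M.infAmplification b p.1‖ - ‖M.infAmplification b p.2‖),
    sq_nonneg ‖M.infAmplification b p.1‖, sq_nonneg ‖M.infAmplification b p.2‖]

theorem norm_toL2_sq (b : M.Elem) : ‖τ.toL2 b‖ ^ 2 = ‖τ.tr (star b * b)‖ := by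
  rw [← inner_toL2, inner_self_eq_norm_sq_to_K]
  simp

/-- Both vectors of every summand become coordinates of the single vector `ζ`, which explains the
index set `J ⊕ J`. -/
theorem norm_sum_normalFunctional_star_mul_self_le {J : Type*} [Fintype J]
    (p : J → lp (fun _ : ℕ => H) 2 × lp (fun _ : ℕ => H) 2) :
    ∃ ζ : lp (fun _ : J ⊕ J => lp (fun _ : ℕ => H) 2) 2, ∀ b,
      ‖∑ j, M.normalFunctional (p j) (star b * b)‖ ≤
        ‖(amplification.comp M.infAmplification) b ζ‖ ^ 2 := by
  refine ⟨⟨Sum.elim (fun j => (p j).1) (fun j => (p j).2), Memℓp.all _⟩, fun b => ?_⟩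
  rw [lp.norm_sq_eq_sum, Fintype.sum_sum_type, ← Finset.sum_add_distrib]
  exact norm_sum_le_of_le _ fun j _ => norm_normalFunctional_star_mul_self_le (p j) b

/-- A linear functional continuous for the topology induced by a family of linear functionals is a
finite linear combination of them; the coefficients are absorbed into the first vectors. -/
theorem IsNormal.exists_tr_eq_sum (hτ : τ.IsNormal) :
    ∃ (s : Finset (lp (fun _ : ℕ => H) 2 × lp (fun _ : ℕ => H) 2))
      (p : s → lp (fun _ : ℕ => H) 2 × lp (fun _ : ℕ => H) 2),
      ∀ b, τ.tr b = ∑ j, M.normalFunctional (p j) b := by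
  have h : τ.tr.toLinearMap ∈ Submodule.span ℂ (Set.range M.normalFunctional) := by
    rw [LinearMap.mem_span_iff_continuous, ← M.weakStar_eq]
    exact hτ
  obtain ⟨c, hc⟩ := Finsupp.mem_span_range_iff_exists_finsupp.1 h
  refine ⟨c.support, fun j => (c j • j.1.1, j.1.2), fun b => ?_⟩
  have h1 : τ.tr b = ∑ p ∈ c.support, c p * M.normalFunctional p b := by
    have := congrArg (fun φ : M.Elem →ₗ[ℂ] ℂ => φ b) hc
    simpa [Finsupp.sum] using this.symm
  rw [h1, ← Finset.sum_coe_sort]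
  refine Finset.sum_congr rfl fun p _ => ?_
  rw [M.normalFunctional_apply, M.normalFunctional_apply, map_smul, inner_smul_right]

/-- For a normal trace, `b ↦ ⟪ξ, η b⟫` is weak⋆ continuous for all `ξ, η ∈ L²(M)`. -/
theorem IsNormal.continuous_inner_rightMul (hτ : τ.IsNormal) (ξ η : τ.L2) :
    Continuous[M.weakStar, inferInstance] fun b => ⟪ξ, τ.rightMul b η⟫_ℂ := by
  obtain ⟨s, p, hp⟩ := hτ.exists_tr_eq_sum
  obtain ⟨ζ, hζ⟩ := norm_sum_normalFunctional_star_mul_self_le (M := M) p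
  have hdom : ∀ b, ‖τ.toL2 b‖ ≤ ‖(amplification.comp M.infAmplification) b ζ‖ := fun b => by
    refine le_of_sq_le_sq ((norm_toL2_sq b).trans_le ?_) (norm_nonneg _)
    exact (congrArg norm (hp (star b * b))).trans_le (hζ b)
  obtain ⟨u, v, huv⟩ := exists_inner_rightMul_eq hdom ξ η
  -- The outer index set is finite, so the coefficient given by `u, v` is a finite sum of normal
  -- functionals.
  convert! M.continuous_sum_normalFunctional fun j => (v j, u j) using 2 with b
  rw [huv, lp.inner_eq_tsum, tsum_fintype]
  rfl

end FaithfulTracialState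

/-! ### Orthogonal sums of closed subspaces -/

namespace Submodule

variable {E : Type*} [NormedAddCommGroup E] [InnerProductSpace ℂ E]
  {K L X : Submodule ℂ E}

/-- Subtracting both projections from a point of `(K ⊔ L)ᗮᗮ` leaves a vector lying also in `(K ⊔
L)ᗮ`, hence zero. -/
theorem IsOrtho.isClosed_sup [CompleteSpace E] (h : K ⟂ L) (hK : IsClosed (K : Set E)) (hL : IsClosed (L : Set E)) :
    IsClosed ((K ⊔ L : Submodule ℂ E) : Set E) := by
  have := hK.completeSpace_coe
  have := hL.completeSpace_coe
  have hle : (K ⊔ L)ᗮᗮ ≤ K ⊔ L := by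
    intro x hx
    have hk : K.starProjection x ∈ K ⊔ L := mem_sup_left (K.starProjection_apply_mem x)
    have hl : L.starProjection x ∈ K ⊔ L := mem_sup_right (L.starProjection_apply_mem x)
    have h0 : x - K.starProjection x - L.starProjection x ∈ (K ⊔ L)ᗮ := by
      rw [← inf_orthogonal]
      refine ⟨sub_mem (K.sub_starProjection_mem_orthogonal x)
        (h.symm.le (L.starProjection_apply_mem x)), ?_⟩
      rw [sub_right_comm]
      exact sub_mem (L.sub_starProjection_mem_orthogonal x)
        (h.le (K.starProjection_apply_mem x))
    have h1 : x - K.starProjection x - L.starProjection x ∈ (K ⊔ L)ᗮᗮ :=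
      sub_mem (sub_mem hx (le_orthogonal_orthogonal _ hk)) (le_orthogonal_orthogonal _ hl)
    have h2 := (mem_bot ℂ).1 ((inf_orthogonal_eq_bot (K ⊔ L)ᗮ).le ⟨h0, h1⟩)
    rw [sub_sub, sub_eq_zero] at h2
    rw [h2]
    exact add_mem hk hl
  rw [le_antisymm (le_orthogonal_orthogonal _) hle]
  exact isClosed_orthogonal _

theorem IsOrtho.inf_orthogonal_of_eq_sup (h : K ⟂ L) (hX : X = K ⊔ L) : X ⊓ Kᗮ = L := by
  rw [hX, sup_comm, sup_inf_assoc_of_le K h.symm.le, inf_orthogonal_eq_bot, sup_bot_eq]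

end Submodule

theorem iSup_cons_pair {α : Type*} [CompleteLattice α] (a b : α) :
    ⨆ i, ![a, b] i = a ⊔ b := by
  rw [iSup, Matrix.range_cons, Matrix.range_cons, Matrix.range_empty, Set.union_empty,
    Set.singleton_union, sSup_pair]

namespace FaithfulTracialState

/-! ### Calculus of the closed products `[X S]₂` -/

section ClosedMul

variable {M : Type*} [CStarAlgebra M] [PartialOrder M] [StarOrderedRing M]
  {τ : FaithfulTracialState M} {X Y K : Submodule ℂ τ.L2} {S T : Set M}

theorem rightMul_mem_closedMul {x : τ.L2} {a : M} (hx : x ∈ X) (ha : a ∈ S) :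
    τ.rightMul a x ∈ τ.closedMul X S :=
  Submodule.le_topologicalClosure _ (Submodule.subset_span ⟨x, hx, a, ha, rfl⟩)

theorem isClosed_closedMul : IsClosed (τ.closedMul X S : Set τ.L2) :=
  Submodule.isClosed_topologicalClosure _

theorem closedMul_le (hK : IsClosed (K : Set τ.L2))
    (h : ∀ x ∈ X, ∀ a ∈ S, τ.rightMul a x ∈ K) : τ.closedMul X S ≤ K := by
  refine Submodule.topologicalClosure_minimal _ (Submodule.span_le.2 ?_) hK
  rintro _ ⟨x, hx, a, ha, rfl⟩
  exact h x hx a ha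

theorem closedMul_mono (hXY : X ≤ Y) (hST : S ⊆ T) : τ.closedMul X S ≤ τ.closedMul Y T :=
  closedMul_le isClosed_closedMul fun _ hx _ ha => rightMul_mem_closedMul (hXY hx) (hST ha)

theorem le_closedMul (hS : 1 ∈ S) : X ≤ τ.closedMul X S := fun x hx => by
  simpa only [rightMul_one] using rightMul_mem_closedMul (τ := τ) hx hS

theorem rightMul_closedMul_mem {b : M} (hK : IsClosed (K : Set τ.L2))
    (h : ∀ x ∈ X, ∀ a ∈ S, τ.rightMul (a * b) x ∈ K) {ξ : τ.L2} (hξ : ξ ∈ τ.closedMul X S) :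
    τ.rightMul b ξ ∈ K := by
  have : τ.closedMul X S ≤ K.comap (τ.rightMul b).toLinearMap := by
    refine closedMul_le (hK.preimage (τ.rightMul b).continuous) fun x hx a ha => ?_
    have := h x hx a ha
    rwa [← rightMul_rightMul] at this
  exact this hξ

theorem mem_orthogonal_closedMul {v : τ.L2}
    (h : ∀ x ∈ X, ∀ a ∈ S, ⟪τ.rightMul a x, v⟫_ℂ = 0) : v ∈ (τ.closedMul X S)ᗮ := by
  have : τ.closedMul X S ≤ (ℂ ∙ v)ᗮ := closedMul_le (Submodule.isClosed_orthogonal _)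
    fun x hx a ha => Submodule.mem_orthogonal_singleton_iff_inner_left.2 (h x hx a ha)
  exact fun w hw => Submodule.mem_orthogonal_singleton_iff_inner_left.1 (this hw)

/-- `ξ⋆ x = 0` means `ξ ⟂ x M`, and `x a M ⊆ x M`. -/
theorem starMul_closedMul_eq_zero {ξ : τ.L2} (h : ∀ x ∈ X, τ.starMul ξ x = 0) :
    ∀ η ∈ τ.closedMul X S, τ.starMul ξ η = 0 := by
  intro η hη
  refine τ.starMul_eq_zero_iff.2 fun b => ?_
  refine Submodule.mem_orthogonal_singleton_iff_inner_right.1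
    (rightMul_closedMul_mem (Submodule.isClosed_orthogonal _) (fun x hx a _ => ?_) hη)
  exact Submodule.mem_orthogonal_singleton_iff_inner_right.2
    (τ.starMul_eq_zero_iff.1 (h x hx) _)

theorem starMul_eq_zero_symm {ξ η : τ.L2} (h : τ.starMul ξ η = 0) : τ.starMul η ξ = 0 := by
  refine τ.starMul_eq_zero_iff.2 fun b => ?_
  have := τ.starMul_eq_zero_iff.1 h (star b)
  rw [← inner_conj_symm, inner_rightMul_left, this, map_zero]

end ClosedMul

/-! ### Structure and uniqueness of decompositions -/

section Decomposition

variable {H : Type*} [NormedAddCommGroup H] [InnerProductSpace ℂ H] [CompleteSpace H]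
  {M : VonNeumannAlgebra H} {τ : FaithfulTracialState M.Elem} {A : Subalgebra ℂ M.Elem}
  {K X Y Z Y' Z' : Submodule ℂ τ.L2}

theorem IsInvariant.closedMul_zeroPart_le (hK : τ.IsInvariant A K) :
    τ.closedMul K (τ.zeroPart A) ≤ K :=
  closedMul_le hK.isClosed fun x hx a ha => hK.rightMul_mem x hx a ha.1

theorem IsTypeTwo.closedMul_zeroPart_eq (hK : τ.IsTypeTwo A K) :
    τ.closedMul K (τ.zeroPart A) = K := by
  have hle := hK.toIsInvariant.closedMul_zeroPart_le
  have := (isClosed_closedMul (τ := τ) (X := K) (S := τ.zeroPart A)).completeSpace_coe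
  have := Submodule.sup_orthogonal_inf_of_hasOrthogonalProjection hle
  have hb := hK.wandering_eq_bot
  rw [wandering, inf_comm] at hb
  rwa [hb, sup_bot_eq] at this

/-- Closed right `𝒟`-submodules satisfy `[Y 𝒟]₂ = Y`. -/
theorem IsDiagSubmodule.closedMul_eq (h : τ.IsDiagSubmodule A Y) (hY : IsClosed (Y : Set τ.L2)) :
    τ.closedMul Y (diag A) = Y :=
  le_antisymm (closedMul_le hY h) (le_closedMul (diag A).one_mem)

theorem isDiagSubmodule_closedMul : τ.IsDiagSubmodule A (τ.closedMul Y (diag A)) :=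
  fun _ hy _ hd => rightMul_closedMul_mem isClosed_closedMul
    (fun _ hx _ ha => rightMul_mem_closedMul hx ((diag A).mul_mem ha hd)) hy

theorem closedMul_closedMul_diag :
    τ.closedMul (τ.closedMul Y (diag A)) A = τ.closedMul Y A :=
  le_antisymm
    (closedMul_le isClosed_closedMul fun _ hx _ ha => rightMul_closedMul_mem isClosed_closedMul
      (fun _ hy _ hd => rightMul_mem_closedMul hy (A.mul_mem (diag_le hd) ha)) hx)
    (closedMul_mono (le_closedMul (diag A).one_mem) subset_rfl)

theorem isInvariant_closedMul : τ.IsInvariant A (τ.closedMul Y A) :=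
  ⟨isClosed_closedMul, fun _ hx _ ha => rightMul_closedMul_mem isClosed_closedMul
    (fun _ hy _ hb => rightMul_mem_closedMul hy (A.mul_mem hb ha)) hx⟩

theorem IsInvariant.sup (h : K ⟂ X) (hK : τ.IsInvariant A K) (hX : τ.IsInvariant A X) :
    τ.IsInvariant A (K ⊔ X) := by
  refine ⟨h.isClosed_sup hK.isClosed hX.isClosed, fun x hx a ha => ?_⟩
  obtain ⟨k, hk, y, hy, rfl⟩ := Submodule.mem_sup.1 hx
  rw [map_add]
  exact Submodule.add_mem_sup (hK.rightMul_mem k hk a ha) (hX.rightMul_mem y hy a ha)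

/-- For generators this is the bimodule property `Φ(e b d⋆) = e Φ(b) d⋆`; the closure is then taken
in one variable at a time. -/
theorem IsTracialSubalgebra.starMul_closedMul_diag_mem (hA : τ.IsTracialSubalgebra A)
    (hY : ∀ y ∈ Y, ∀ x ∈ Y, τ.starMul y x ∈ τ.L1Of (diag A)) :
    ∀ y ∈ τ.closedMul Y (diag A), ∀ x ∈ τ.closedMul Y (diag A),
      τ.starMul y x ∈ τ.L1Of (diag A) := by
  have hcl : IsClosed (τ.L1Of (diag A) : Set τ.L1) := Submodule.isClosed_topologicalClosure _
  have key : ∀ y ∈ Y, ∀ x ∈ Y, ∀ d ∈ diag A, ∀ e ∈ diag A,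
      τ.starMul (τ.rightMul d y) (τ.rightMul e x) ∈ τ.L1Of (diag A) := by
    intro y hy x hx d hd e he
    have h := hA.isCondExp.starMul_mem_L1Of_iff.1 (hY y hy x hx)
    refine hA.isCondExp.starMul_mem_L1Of_iff.2 fun b => ?_
    simp only [inner_rightMul_left, rightMul_rightMul]
    rw [h, hA.isCondExp.map_mul_mul b e he _ (star_mem_diag hd)]
  have hright : ∀ y ∈ Y, ∀ d ∈ diag A, ∀ x ∈ τ.closedMul Y (diag A),
      τ.starMul (τ.rightMul d y) x ∈ τ.L1Of (diag A) := fun y hy d hd x hx => by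
    have : τ.closedMul Y (diag A) ≤
        (τ.L1Of (diag A)).comap (τ.starMul (τ.rightMul d y)).toLinearMap :=
      closedMul_le (hcl.preimage (τ.starMul _).continuous) fun z hz e he => key y hy z hz d hd e he
    exact this hx
  intro y hy x hx
  have : τ.closedMul Y (diag A) ≤
      (τ.L1Of (diag A)).comap (τ.starMul.flip x).toLinearMap :=
    closedMul_le (hcl.preimage (τ.starMul.flip x).continuous)
      fun z hz d hd => hright z hz d hd x hx
  exact this hy

/-- If `Y⋆ Y ⊆ L¹(𝒟)` then `Y 𝒟` is orthogonal to `Y A₀`. -/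
theorem IsTracialSubalgebra.inner_rightMul_diag_zeroPart (hA : τ.IsTracialSubalgebra A)
    {y x : τ.L2} (h : τ.starMul y x ∈ τ.L1Of (diag A)) {d a : M.Elem} (hd : d ∈ diag A)
    (ha : a ∈ τ.zeroPart A) : ⟪τ.rightMul d y, τ.rightMul a x⟫_ℂ = 0 := by
  -- The inner product is `⟪y, x (a d⋆)⟫`, where `a d⋆` may be replaced by `Φ(a d⋆) = Φ(a) d⋆ = 0`.
  rw [inner_rightMul_left, rightMul_rightMul, hA.isCondExp.starMul_mem_L1Of_iff.1 h,
    hA.isCondExp.map_mul_right (star_mem_diag hd), LinearMap.mem_ker.1 ha.2, zero_mul,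
    rightMul_zero, inner_zero_right]

namespace IsDecomposition

theorem left_isOrtho (h : τ.IsDecomposition A X Z Y) : Z ⟂ τ.closedMul Y A :=
  Submodule.isOrtho_iff_inner_eq.2 fun z hz y hy => τ.inner_eq_zero_of_starMul_eq_zero
    (h.isColumnSum.starMul_eq_zero 0 1 (by decide) z hz y hy)

/-- The column condition implies orthogonality, so the dense sum is already closed. -/
theorem eq_sup (h : τ.IsDecomposition A X Z Y) : X = Z ⊔ τ.closedMul Y A := by
  refine le_antisymm ?_ (sup_le h.left_le (h.isColumnSum.le 1))
  have hd := h.isColumnSum.dense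
  rwa [iSup_cons_pair, (h.left_isOrtho.isClosed_sup h.isTypeTwo.isClosed
    isClosed_closedMul).submodule_topologicalClosure_eq] at hd

theorem isInvariant (h : τ.IsDecomposition A X Z Y) : τ.IsInvariant A X := by
  rw [h.eq_sup]
  exact .sup h.left_isOrtho h.isTypeTwo.toIsInvariant isInvariant_closedMul

theorem closedMul_diag_le (h : τ.IsDecomposition A X Z Y) : τ.closedMul Y (diag A) ≤ X :=
  (closedMul_mono le_rfl diag_le).trans (h.isColumnSum.le 1)

/-- `Z A₀ ⊆ Z` is orthogonal to all of `[Y A]₂`, while `Y A A₀ ⊆ Y A₀` is orthogonal to `Y 𝒟`. -/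
theorem isOrtho (hA : τ.IsTracialSubalgebra A) (h : τ.IsDecomposition A X Z Y) :
    τ.closedMul X (τ.zeroPart A) ⟂ τ.closedMul Y (diag A) := by
  refine closedMul_le (Submodule.isClosed_orthogonal _) fun x hx a ha => ?_
  rw [h.eq_sup] at hx
  obtain ⟨z, hz, u, hu, rfl⟩ := Submodule.mem_sup.1 hx
  rw [map_add]
  refine add_mem (Submodule.orthogonal_le (closedMul_mono le_rfl diag_le)
    (h.left_isOrtho.le (h.isTypeTwo.rightMul_mem z hz a ha.1)))
    (rightMul_closedMul_mem (Submodule.isClosed_orthogonal _) (fun x hx b hb => ?_) hu)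
  exact mem_orthogonal_closedMul fun y hy d hd => hA.inner_rightMul_diag_zeroPart
    (h.starMul_mem y hy x hx) hd (hA.mul_mem_zeroPart hb ha)

/-- `Z = [Z A₀]₂` is absorbed by `[X A₀]₂`, and `a = (a - Φ(a)) + Φ(a)` splits `Y A`. -/
theorem eq_sup_closedMul (hA : τ.IsTracialSubalgebra A) (h : τ.IsDecomposition A X Z Y) :
    X = τ.closedMul X (τ.zeroPart A) ⊔ τ.closedMul Y (diag A) := by
  refine le_antisymm ?_ (sup_le h.isInvariant.closedMul_zeroPart_le h.closedMul_diag_le)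
  conv_lhs => rw [h.eq_sup]
  refine sup_le ?_ (closedMul_le ((h.isOrtho hA).isClosed_sup isClosed_closedMul
    isClosed_closedMul) fun y hy a ha => ?_)
  · rw [← h.isTypeTwo.closedMul_zeroPart_eq]
    exact (closedMul_mono h.left_le subset_rfl).trans le_sup_left
  · rw [← sub_add_cancel a (τ.condExp (diag A) a), rightMul_add]
    exact Submodule.add_mem_sup (rightMul_mem_closedMul (h.right_le hy) (hA.sub_condExp_mem ha))
      (rightMul_mem_closedMul hy (hA.isCondExp.map_mem a))

theorem closedMul_diag_eq (hA : τ.IsTracialSubalgebra A) (h : τ.IsDecomposition A X Z Y) :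
    τ.closedMul Y (diag A) = τ.wandering A X :=
  ((h.isOrtho hA).inf_orthogonal_of_eq_sup (h.eq_sup_closedMul hA)).symm

theorem isSimplyInvariant_iff (hA : τ.IsTracialSubalgebra A) (h : τ.IsDecomposition A X Z Y) :
    τ.IsSimplyInvariant A X ↔ Y ≠ ⊥ := by
  have hle := h.isInvariant.closedMul_zeroPart_le
  constructor
  · rintro hX rfl
    refine hX.lt.not_ge ?_
    conv_lhs => rw [h.eq_sup_closedMul hA]
    refine sup_le le_rfl ((closedMul_le isClosed_closedMul ?_))
    intro x hx a _
    rw [(Submodule.mem_bot ℂ).1 hx, map_zero]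
    exact zero_mem _
  · refine fun hY => ⟨h.isInvariant, hle.lt_of_ne fun heq => hY ?_⟩
    have h1 := h.closedMul_diag_eq hA
    rw [wandering, heq, Submodule.inf_orthogonal_eq_bot] at h1
    exact le_bot_iff.1 (h1 ▸ le_closedMul (diag A).one_mem)

theorem closedMul_diag (hA : τ.IsTracialSubalgebra A) (h : τ.IsDecomposition A X Z Y) :
    τ.IsDecomposition A X Z (τ.closedMul Y (diag A)) where
  left_le := h.left_le
  right_le := h.closedMul_diag_le
  isClosed_right := isClosed_closedMul
  isTypeTwo := h.isTypeTwo
  starMul_mem := hA.starMul_closedMul_diag_mem h.starMul_mem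
  isColumnSum := by rw [closedMul_closedMul_diag]; exact h.isColumnSum

theorem closedMul_diag_unique (hA : τ.IsTracialSubalgebra A) (h : τ.IsDecomposition A X Z Y)
    (h' : τ.IsDecomposition A X Z' Y') : τ.closedMul Y (diag A) = τ.closedMul Y' (diag A) := by
  rw [h.closedMul_diag_eq hA, h'.closedMul_diag_eq hA]

theorem left_unique (hA : τ.IsTracialSubalgebra A) (h : τ.IsDecomposition A X Z Y)
    (h' : τ.IsDecomposition A X Z' Y') : Z = Z' := by
  have e : τ.closedMul Y A = τ.closedMul Y' A := by
    rw [← closedMul_closedMul_diag, h.closedMul_diag_unique hA h', closedMul_closedMul_diag]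
  rw [← h.left_isOrtho.symm.inf_orthogonal_of_eq_sup (h.eq_sup.trans (sup_comm _ _)),
    ← h'.left_isOrtho.symm.inf_orthogonal_of_eq_sup (h'.eq_sup.trans (sup_comm _ _)), e]

end IsDecomposition

/-! ### Maximal subdiagonal algebras -/

namespace IsMaximalSubdiagonal

theorem eq_of_continuous (hA : τ.IsMaximalSubdiagonal A) {f g : M.Elem → ℂ}
    (hf : Continuous[M.weakStar, inferInstance] f) (hg : Continuous[M.weakStar, inferInstance] g)
    (h : ∀ a ∈ A, ∀ b ∈ A, f (a + star b) = g (a + star b)) : f = g := by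
  let _ := M.weakStar
  refine Continuous.ext_on hA.dense hf hg ?_
  rintro _ ⟨a, ha, b, hb, rfl⟩
  exact h a ha b hb

/-- By weak⋆ continuity only `a + b⋆` with `a, b ∈ A` need testing. Subtracting `Φ(a + b⋆)` leaves
an element of `A₀ + A₀⋆`, annihilated by the two hypotheses. -/
theorem starMul_mem_L1Of (hA : τ.IsMaximalSubdiagonal A) (hτ : τ.IsNormal) {y x : τ.L2}
    (hyx : ∀ a ∈ τ.zeroPart A, ⟪y, τ.rightMul a x⟫_ℂ = 0)
    (hxy : ∀ a ∈ τ.zeroPart A, ⟪τ.rightMul a y, x⟫_ℂ = 0) :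
    τ.starMul y x ∈ τ.L1Of (diag A) := by
  have hΦ := hA.isCondExp
  refine hΦ.starMul_mem_L1Of_iff.2 (congrFun (hA.eq_of_continuous
    (hτ.continuous_inner_rightMul y x)
    (@Continuous.comp _ _ _ M.weakStar M.weakStar _ _ _ (hτ.continuous_inner_rightMul y x)
      hΦ.normal) fun a ha b hb => ?_))
  set Φ := τ.condExp (diag A)
  have e : a + star b = (a - Φ a) + star (b - Φ b) + Φ (a + star b) := by
    rw [map_add, hΦ.map_star, star_sub]
    abel
  change _ = ⟪y, τ.rightMul (Φ (a + star b)) x⟫_ℂ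
  conv_lhs => rw [e]
  rw [rightMul_add, rightMul_add, inner_add_right, inner_add_right,
    hyx _ (hA.sub_condExp_mem ha), ← inner_rightMul_left, hxy _ (hA.sub_condExp_mem hb),
    zero_add, zero_add]

/-- Orthogonality to `y A` is assumed; orthogonality to `y A₀⋆` holds because `⟪z, y b⋆⟫ = ⟪z b, y⟫`
and `y ⟂ X A₀`. Together these cover `A + A⋆`. -/
theorem starMul_wandering_eq_zero (hA : τ.IsMaximalSubdiagonal A) (hτ : τ.IsNormal) {z y : τ.L2}
    (hz : z ∈ X) (hzy : ∀ a ∈ A, ⟪z, τ.rightMul a y⟫_ℂ = 0) (hy : y ∈ τ.wandering A X) :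
    τ.starMul z y = 0 := by
  refine τ.starMul_eq_zero_iff.2 (congrFun (hA.eq_of_continuous
    (hτ.continuous_inner_rightMul z y) (@continuous_const _ _ M.weakStar _ 0) fun a ha b hb => ?_))
  set Φ := τ.condExp (diag A)
  have hb' : ⟪z, τ.rightMul (star (b - Φ b)) y⟫_ℂ = 0 := by
    rw [← inner_rightMul_left]
    exact hy.2 _ (rightMul_mem_closedMul hz (hA.sub_condExp_mem hb))
  have e : a + star b = (a + star (Φ b)) + star (b - Φ b) := by
    rw [star_sub]
    abel
  rw [e, rightMul_add, inner_add_right, hb', hzy _ (A.add_mem ha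
    (diag_le (star_mem_diag (hA.isCondExp.map_mem b)))), add_zero]

theorem exists_isDecomposition (hA : τ.IsMaximalSubdiagonal A) (hτ : τ.IsNormal)
    (hX : τ.IsInvariant A X) :
    ∃ Z, τ.IsDecomposition A X Z (τ.wandering A X) := by
  set Y := τ.wandering A X
  have hYX : Y ≤ X := inf_le_left
  have hYA : τ.closedMul Y A ≤ X :=
    closedMul_le hX.isClosed fun y hy a ha => hX.rightMul_mem y (hYX hy) a ha
  have hZY : ∀ z ∈ X ⊓ (τ.closedMul Y A)ᗮ, ∀ y ∈ Y, τ.starMul z y = 0 := fun z hz y hy =>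
    hA.starMul_wandering_eq_zero hτ hz.1 (fun a ha => by
      rw [← inner_conj_symm, hz.2 _ (rightMul_mem_closedMul hy ha), map_zero]) hy
  have hZYA : ∀ z ∈ X ⊓ (τ.closedMul Y A)ᗮ, ∀ y ∈ τ.closedMul Y A, τ.starMul z y = 0 :=
    fun z hz => starMul_closedMul_eq_zero (hZY z hz)
  have hsup : τ.closedMul Y A ⊔ X ⊓ (τ.closedMul Y A)ᗮ = X := by
    have := (isClosed_closedMul (τ := τ) (X := Y) (S := A)).completeSpace_coe
    rw [inf_comm]
    exact Submodule.sup_orthogonal_inf_of_hasOrthogonalProjection hYA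
  have hZinv : τ.IsInvariant A (X ⊓ (τ.closedMul Y A)ᗮ) := by
    refine ⟨hX.isClosed.inter (Submodule.isClosed_orthogonal _), fun z hz a ha =>
      ⟨hX.rightMul_mem z hz.1 a ha, fun y hy => ?_⟩⟩
    -- Orthogonality to `[Y A]₂` alone would not survive multiplication by `a`; the vanishing of the
    -- product does.
    exact τ.starMul_eq_zero_iff.1 (starMul_eq_zero_symm (hZYA z hz y hy)) a
  refine ⟨X ⊓ (τ.closedMul Y A)ᗮ, inf_le_left, hYX,
    hX.isClosed.inter (Submodule.isClosed_orthogonal _), ⟨hZinv, ?_⟩, ?_, ?_, ?_, ?_⟩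
  · rw [eq_bot_iff]
    intro w hw
    -- A wandering vector of `Z` is wandering for `X`, since `[Y A]₂ A₀ ⊆ [Y A]₂` is orthogonal to
    -- `Z`. It then lies in `[Y A]₂` and in its complement.
    have hwY : w ∈ Y := by
      refine ⟨hw.1.1, mem_orthogonal_closedMul fun x hx a ha => ?_⟩
      rw [← hsup] at hx
      obtain ⟨u, hu, z, hz, rfl⟩ := Submodule.mem_sup.1 hx
      rw [map_add, inner_add_left, hw.1.2 _ (isInvariant_closedMul.rightMul_mem u hu a ha.1),
        hw.2 _ (rightMul_mem_closedMul hz ha), add_zero]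
    exact inner_self_eq_zero.1 (hw.1.2 w (le_closedMul A.one_mem hwY))
  · refine fun y hy x hx => hA.starMul_mem_L1Of hτ (fun a ha => ?_) fun a ha => ?_
    · rw [← inner_conj_symm, hy.2 _ (rightMul_mem_closedMul (hYX hx) ha), map_zero]
    · exact hx.2 _ (rightMul_mem_closedMul (hYX hy) ha)
  · intro i
    fin_cases i
    exacts [inf_le_left, hYA]
  · rw [iSup_cons_pair]
    refine le_trans ?_ (Submodule.le_topologicalClosure _)
    exact hsup.symm.le.trans (sup_comm _ _).le
  · intro i j hij x hx y hy
    fin_cases i <;> fin_cases j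
    · exact absurd rfl hij
    · exact hZYA x hx y hy
    · exact starMul_eq_zero_symm (hZYA y hy x hx)
    · exact absurd rfl hij

end IsMaximalSubdiagonal

end Decomposition

end FaithfulTracialState

end

theorem theorem2p1 {H : Type*} [NormedAddCommGroup H] [InnerProductSpace ℂ H] [CompleteSpace H]
    (M : VonNeumannAlgebra H) (τ : FaithfulTracialState M.Elem) (hτ : τ.IsNormal)
    (A : Subalgebra ℂ M.Elem) (hA : τ.IsTracialSubalgebra A) :
    (∀ X Z Y : Submodule ℂ τ.L2, τ.IsDecomposition A X Z Y →
      (τ.IsSimplyInvariant A X ↔ Y ≠ ⊥) ∧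
      (τ.closedMul Y (FaithfulTracialState.diag A) =
          X ⊓ (τ.closedMul X (τ.zeroPart A))ᗮ ∧
        X = τ.closedMul X (τ.zeroPart A) ⊔ τ.closedMul Y (FaithfulTracialState.diag A) ∧
        τ.closedMul X (τ.zeroPart A) ⟂ τ.closedMul Y (FaithfulTracialState.diag A)) ∧
      (τ.IsDecomposition A X Z (τ.closedMul Y (FaithfulTracialState.diag A)) ∧
        τ.IsDiagSubmodule A (τ.closedMul Y (FaithfulTracialState.diag A)))) ∧
    (∀ X Z Y Z' Y' : Submodule ℂ τ.L2,
      τ.IsDecomposition A X Z Y → τ.IsDecomposition A X Z' Y' →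
      Z = Z' ∧
      τ.closedMul Y (FaithfulTracialState.diag A) =
        τ.closedMul Y' (FaithfulTracialState.diag A) ∧
      (τ.IsDiagSubmodule A Y → τ.IsDiagSubmodule A Y' → Y = Y')) ∧
    (τ.IsMaximalSubdiagonal A → ∀ X : Submodule ℂ τ.L2, τ.IsInvariant A X →
      ∃ Z : Submodule ℂ τ.L2, τ.IsDecomposition A X Z (τ.wandering A X)) := by
  refine ⟨fun X Z Y h => ⟨h.isSimplyInvariant_iff hA, ⟨h.closedMul_diag_eq hA,
    h.eq_sup_closedMul hA, h.isOrtho hA⟩, h.closedMul_diag hA,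
    FaithfulTracialState.isDiagSubmodule_closedMul⟩,
    fun X Z Y Z' Y' h h' => ⟨h.left_unique hA h', h.closedMul_diag_unique hA h',
      fun hY hY' => ?_⟩, fun hmax X hX => hmax.exists_isDecomposition hτ hX⟩
  rw [← hY.closedMul_eq h.isClosed_right, ← hY'.closedMul_eq h'.isClosed_right]
  exact h.closedMul_diag_unique hA h'
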